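/- **Setting.** Let $d\ge 2$ be even and $L\ge 1$. Let $\Omega$ be a compact space with an action $T$ of $\mathbb Z^d$ by homeomorphisms and an invariant ergodic Borel probability measure $\mathbb P$ of full support. Let $U(a)$, $a\in\mathbb Z^d$, be the translations $(U(a)\phi)_n=\phi_{n-a}$ on $\ell^2(\mathbb Z^d,\mathbb C^L)$ or, more generally, the magnetic translations $(U(a)\phi)_n=e^{\frac{\imath}{2}a\cdot Bn}\phi_{n-a}$ for a real $d\times d$ matrix $B$ (an antisymmetric $B$ is a constant magnetic field; $B=0$ gives the ordinary translations). Let $H=(H_\omega)_{\omega\in\Omega}$ be a family of bounded selfadjoint operators on $\ell^2(\mathbb Z^d,\mathbb C^L)$ which is covariant, $U(a)H_\omega U(a)^*=H_{T^a\omega}$ for all $a\in\mathbb Z^d$, whose matrix elements depend continuously on $\omega$, and which is short range: there is $R$ such that all matrix elements between sites $n,m$ with $|n-m|>R$ vanish (nearest neighbor Hamiltonians are the case $R=1$). Let $\mu\in(a,b)$, where the bounded interval $(a,b)$ is a bulk gap: $\sigma(H_\omega)\cap(a,b)=\emptyset$ for $\mathbb P$-almost every $\omega$. Let $\widehat H_\omega$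 be the restriction (compression) of $H_\omega$ to the half-space $\ell^2(\mathbb Z^{d-1}\times\mathbb N,\mathbb C^L)$, $\mathbb N=\{1,2,\dots\}$, let $\Pi_{[1,N]}$ be the restriction from the half-space to the strip $\ell^2(\mathbb Z^{d-1}\times\{1,\dots,N\},\mathbb C^L)$, ${\bf 1}_N$ the identity of the strip, and $$\widehat G^z_N=\Pi_{[1,N]}(\widehat H-z)^{-1}\Pi_{[1,N]}^* .$$ Let $\mathcal E_d$ be the edge algebra: the C$^*$-algebra (with norm $\sup_\omega\|A_\omega\|$) generated by the bounded families $(A_\omega)_{\omega\in\Omega}$ of operators on the half-space that are covariant under the translations $a\in\mathbb Z^{d-1}\times\{0\}$, are short range, have matrix elements continuous in $\omega$, and are supported in some strip $\mathbb Z^{d-1}\times\{1,\dots,N\}$. Let $\mathcal E_d^\sim=\mathbb C{\bf 1}+\mathcal E_d$ be its unitization. $K_1(\mathcal E_d)=K_1(\mathcal E_d^\sim)$ is the inductive limit under $U\mapsto U\oplus 1$ of the groups of homotopy classes of invertible $n\times n$ matrices over $\mathcal E_d^\sim$, written additively; for an operator $V$ on a strip, $[V]_1$ denotes the class of $V\oplus{\bf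 1}$, extended by the identity on the rest of the half-space. **Theorem.** There are $N_0\in\mathbb N$ and $\delta_0>0$ such that the following holds for every smooth non-decreasing $f_{\rm Exp}:\mathbb R\to[0,1]$ equal to $0$ on $(-\infty,a]$ and to $1$ on $[b,\infty)$, all $N\ge N_0$ and all $0<\delta<\delta_0$. The operator $2\delta\,\widehat G_N^{\mu+\imath\delta}+\imath\,{\bf 1}_N$ is invertible, both $$\widehat U=e^{2\pi\imath f_{\rm Exp}(\widehat H)}\qquad\text{and}\qquad \big(2\delta\,\widehat G_N^{\mu+\imath\delta}-\imath{\bf 1}_N\big)\big(2\delta\,\widehat G_N^{\mu+\imath\delta}+\imath{\bf 1}_N\big)^{-1}\oplus{\bf 1}$$ are invertible elements of $\mathcal E_d^\sim$, and $$[\widehat U]_1\;=\;-\Big[\big(2\delta\,\widehat G_N^{\mu+\imath\delta}-\imath{\bf 1}_N\big)\big(2\delta\,\widehat G_N^{\mu+\imath\delta}+\imath{\bf 1}_N\big)^{-1}\Big]_1\in K_1(\mathcal E_d).$$ -/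

import Mathlib

open scoped ENNReal Matrix
open MeasureTheory

/-! ### The `K₁`-group of a unital topological ring

`K₁(R)` is the inductive limit over `n`, along `U ↦ U ⊕ 1`, of the groups `GL_n(R) / GL_n(R)₀`
of homotopy classes of invertible `n × n` matrices. -/

namespace KOne

/-- `GL_n(R)`, with its topology as a group of units. -/
abbrev GLn (R : Type*) [Ring R] (n : ℕ) : Type _ := (Matrix (Fin n) (Fin n) R)ˣ

/-- The `m × n` matrix `(1, 0)ᵀ` of the inclusion of the first `n` coordinates into `m`. -/
def inclMatrix (R : Type*) [Ring R] (m n : ℕ) : Matrix (Fin m) (Fin n) R :=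
  Matrix.of fun i j => if i.val = j.val then 1 else 0

/-- The matrix `M ⊕ 1_{m-n}`, for `M` of size `n ≤ m`. -/
def padMatrix {R : Type*} [Ring R] {n : ℕ} (m : ℕ) (M : Matrix (Fin n) (Fin n) R) :
    Matrix (Fin m) (Fin m) R :=
  inclMatrix R m n * M * (inclMatrix R m n)ᵀ + (1 - inclMatrix R m n * (inclMatrix R m n)ᵀ)

theorem inclMatrix_transpose (R : Type*) [Ring R] (m n : ℕ) :
    (inclMatrix R m n)ᵀ = inclMatrix R n m := by
  ext i j
  simp [inclMatrix, eq_comm]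

theorem inclMatrix_mul (R : Type*) [Ring R] {k m n : ℕ} (h : n ≤ m) :
    inclMatrix R k m * inclMatrix R m n = inclMatrix R k n := by
  ext i j
  rw [Matrix.mul_apply, Finset.sum_eq_single (Fin.castLE h j)]
  · simp [inclMatrix]
  · intro b _ hb
    have : b.val ≠ j.val := fun h' => hb (Fin.ext h')
    simp [inclMatrix, this]
  · simp

theorem inclMatrix_self (R : Type*) [Ring R] (n : ℕ) : inclMatrix R n n = 1 := by
  ext i j
  simp [inclMatrix, Matrix.one_apply, Fin.ext_iff]

theorem inclMatrix_transpose_mul (R : Type*) [Ring R] {m n : ℕ} (h : n ≤ m) :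
    (inclMatrix R m n)ᵀ * inclMatrix R m n = 1 := by
  rw [inclMatrix_transpose, inclMatrix_mul R h, inclMatrix_self]

theorem padMatrix_one {R : Type*} [Ring R] {n : ℕ} (m : ℕ) :
    padMatrix m (1 : Matrix (Fin n) (Fin n) R) = 1 := by
  simp [padMatrix]

theorem padMatrix_mul {R : Type*} [Ring R] {n m : ℕ} (h : n ≤ m)
    (M N : Matrix (Fin n) (Fin n) R) :
    padMatrix m (M * N) = padMatrix m M * padMatrix m N := by
  have key := inclMatrix_transpose_mul R h
  unfold padMatrix
  set E := inclMatrix R m n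
  have h1 : ∀ A : Matrix (Fin n) (Fin m) R, Eᵀ * (E * A) = A := fun A => by
    rw [← Matrix.mul_assoc, key, Matrix.one_mul]
  simp only [Matrix.mul_add, Matrix.add_mul, Matrix.mul_sub, Matrix.sub_mul, Matrix.mul_one,
    Matrix.one_mul, Matrix.mul_assoc, h1]
  abel

theorem padMatrix_self {R : Type*} [Ring R] {n : ℕ} (M : Matrix (Fin n) (Fin n) R) :
    padMatrix n M = M := by
  simp [padMatrix, inclMatrix_self]

theorem padMatrix_padMatrix {R : Type*} [Ring R] {n m k : ℕ} (h : n ≤ m) (_h : m ≤ k)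
    (M : Matrix (Fin n) (Fin n) R) :
    padMatrix k (padMatrix m M) = padMatrix k M := by
  have e1 : inclMatrix R k m * inclMatrix R m n = inclMatrix R k n := inclMatrix_mul R h
  have e2 : (inclMatrix R m n)ᵀ * (inclMatrix R k m)ᵀ = (inclMatrix R k n)ᵀ := by
    simp only [inclMatrix_transpose]
    ext i j
    rw [Matrix.mul_apply, Finset.sum_eq_single (Fin.castLE h i)]
    · simp [inclMatrix]
    · intro b _ hb
      have : i.val ≠ b.val := fun h'' => hb (Fin.ext h''.symm)
      simp [inclMatrix, this]
    · simp
  unfold padMatrix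
  simp only [Matrix.mul_add, Matrix.add_mul, Matrix.mul_sub, Matrix.sub_mul, Matrix.mul_one]
  have e3 : inclMatrix R k m * (inclMatrix R m n * M * (inclMatrix R m n)ᵀ) * (inclMatrix R k m)ᵀ
      = inclMatrix R k n * M * (inclMatrix R k n)ᵀ := by
    rw [← e2]; simp only [Matrix.mul_assoc, ← e1]
  have e4 : inclMatrix R k m * (inclMatrix R m n * (inclMatrix R m n)ᵀ) * (inclMatrix R k m)ᵀ
      = inclMatrix R k n * (inclMatrix R k n)ᵀ := by
    rw [← e2]; simp only [Matrix.mul_assoc, ← e1]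
  rw [e3, e4]
  abel

/-- The stabilisation `GL_n(R) → GL_m(R)`, `U ↦ U ⊕ 1_{m-n}`. -/
def pad (R : Type*) [Ring R] {n m : ℕ} (h : n ≤ m) : GLn R n →* GLn R m :=
  Units.map
    { toFun := padMatrix m
      map_one' := padMatrix_one m
      map_mul' := padMatrix_mul h }

theorem continuous_pad (R : Type*) [Ring R] [TopologicalSpace R] [IsTopologicalRing R]
    {n m : ℕ} (h : n ≤ m) : Continuous (pad R h) := by
  apply Continuous.units_map
  change Continuous (fun M : Matrix (Fin n) (Fin n) R => padMatrix m M)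
  unfold padMatrix
  fun_prop

/-- `GL_n(R) / GL_n(R)₀`: invertible matrices up to homotopy (paths of invertibles). -/
abbrev PiZeroGL (R : Type*) [Ring R] [TopologicalSpace R] [IsTopologicalRing R] (n : ℕ) : Type _ :=
  GLn R n ⧸ Subgroup.pathComponentOne (GLn R n)

theorem pathComponentOne_le_comap (R : Type*) [Ring R] [TopologicalSpace R] [IsTopologicalRing R]
    {n m : ℕ} (h : n ≤ m) :
    Subgroup.pathComponentOne (GLn R n) ≤ (Subgroup.pathComponentOne (GLn R m)).comap (pad R h) := by
  intro g hg
  have hj : Joined (1 : GLn R n) g := hg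
  change Joined (1 : GLn R m) (pad R h g)
  have := hj.map (continuous_pad R h)
  rwa [map_one] at this

/-- The stabilisation `[U] ↦ [U ⊕ 1]` on homotopy classes. -/
def stab (R : Type*) [Ring R] [TopologicalSpace R] [IsTopologicalRing R]
    (n m : ℕ) (h : n ≤ m) : PiZeroGL R n →* PiZeroGL R m :=
  QuotientGroup.map _ _ (pad R h) (pathComponentOne_le_comap R h)

instance directedSystem (R : Type*) [Ring R] [TopologicalSpace R] [IsTopologicalRing R] :
    DirectedSystem (PiZeroGL R) (fun n m h => stab R n m h) where
  map_self := by
    intro n x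
    induction x using QuotientGroup.induction_on with
    | H g =>
      change QuotientGroup.mk (pad R le_rfl g) = QuotientGroup.mk g
      congr 1
      exact Units.ext (padMatrix_self _)
  map_map := by
    intro k j i hij hjk x
    induction x using QuotientGroup.induction_on with
    | H g =>
      change QuotientGroup.mk (pad R hjk (pad R hij g)) = QuotientGroup.mk (pad R (hij.trans hjk) g)
      congr 1
      exact Units.ext (padMatrix_padMatrix hij hjk _)

end KOne

/-- The group `K₁(R)` of a unital topological ring, written additively. -/
def KOne (R : Type*) [Ring R] [TopologicalSpace R] [IsTopologicalRing R] : Type _ :=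
  Additive (DirectLimit (KOne.PiZeroGL R) (fun n m h => KOne.stab R n m h))

noncomputable instance (R : Type*) [Ring R] [TopologicalSpace R] [IsTopologicalRing R] :
    AddGroup (KOne R) :=
  inferInstanceAs (AddGroup (Additive (DirectLimit (KOne.PiZeroGL R)
    (fun n m h => KOne.stab R n m h))))

/-- The class `[u]₁` of an invertible element, regarded as an invertible `1 × 1` matrix. -/
def KOne.ofUnit {R : Type*} [Ring R] [TopologicalSpace R] [IsTopologicalRing R] (u : Rˣ) :
    KOne R :=
  Additive.ofMul (α := DirectLimit (KOne.PiZeroGL R) (fun n m h => KOne.stab R n m h)) (Quotient.mk _ ⟨1, QuotientGroup.mk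
    (Units.map (Matrix.scalar (Fin 1) : R →+* Matrix (Fin 1) (Fin 1) R).toMonoidHom u)⟩)

/-! ### Tight-binding operators -/

namespace TightBinding

/-- The Hilbert space `ℓ²(X, ℂ^L)` over a set `X ⊆ ℤ^d` of lattice sites. -/
def L2 {d : ℕ} (X : Set (Fin d → ℤ)) (L : ℕ) : Type :=
  lp (fun _ : X => EuclideanSpace ℂ (Fin L)) 2

noncomputable instance {d : ℕ} (X : Set (Fin d → ℤ)) (L : ℕ) : NormedAddCommGroup (L2 X L) :=
  inferInstanceAs (NormedAddCommGroup (lp (fun _ : X => EuclideanSpace ℂ (Fin L)) 2))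

noncomputable instance {d : ℕ} (X : Set (Fin d → ℤ)) (L : ℕ) : InnerProductSpace ℂ (L2 X L) :=
  inferInstanceAs (InnerProductSpace ℂ (lp (fun _ : X => EuclideanSpace ℂ (Fin L)) 2))

instance {d : ℕ} (X : Set (Fin d → ℤ)) (L : ℕ) : CompleteSpace (L2 X L) :=
  inferInstanceAs (CompleteSpace (lp (fun _ : X => EuclideanSpace ℂ (Fin L)) 2))

/-- The value `φ_n ∈ ℂ^L` of `φ` at the site `n`. -/
def L2.val {d L : ℕ} {X : Set (Fin d → ℤ)} (φ : L2 X L) (n : X) : EuclideanSpace ℂ (Fin L) :=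
  (show lp (fun _ : X => EuclideanSpace ℂ (Fin L)) 2 from φ) n

/-- The vector `δ_n ⊗ v`, equal to `v` at the site `n` and to `0` elsewhere. -/
noncomputable def L2.single {d L : ℕ} {X : Set (Fin d → ℤ)} (n : X)
    (v : EuclideanSpace ℂ (Fin L)) : L2 X L :=
  (lp.single 2 n v : lp (fun _ : X => EuclideanSpace ℂ (Fin L)) 2)

/-- The bounded operators on `ℓ²(X, ℂ^L)`. -/
abbrev Op {d : ℕ} (X : Set (Fin d → ℤ)) (L : ℕ) : Type := L2 X L →L[ℂ] L2 X L

/-- The matrix element `π_n A π_m^*` of `A`, applied to `v ∈ ℂ^L`. -/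
noncomputable def entry {d L : ℕ} {X : Set (Fin d → ℤ)} (A : Op X L) (n m : X)
    (v : EuclideanSpace ℂ (Fin L)) : EuclideanSpace ℂ (Fin L) :=
  (A (L2.single m v)).val n

/-- The restriction `ℓ²(Y, ℂ^L) → ℓ²(X, ℂ^L)` of functions, for `X ⊆ Y`. -/
noncomputable def restr {d : ℕ} (L : ℕ) {X Y : Set (Fin d → ℤ)} (h : X ⊆ Y) :
    L2 Y L →L[ℂ] L2 X L :=
  LinearMap.mkContinuous
    (show lp (fun _ : Y => EuclideanSpace ℂ (Fin L)) 2 →ₗ[ℂ]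
        lp (fun _ : X => EuclideanSpace ℂ (Fin L)) 2 from
      { toFun := fun φ => ⟨fun x => φ (Set.inclusion h x), by
          have hφ := (memℓp_gen_iff (by norm_num)).1 (lp.memℓp φ)
          exact memℓp_gen (hφ.comp_injective (Set.inclusion_injective h))⟩
        map_add' := fun _ _ => rfl
        map_smul' := fun _ _ => rfl }) 1 (by
    intro φ
    change lp (fun _ : Y => EuclideanSpace ℂ (Fin L)) 2 at φ
    have hφ := (memℓp_gen_iff (p := 2) (by norm_num)).1 (lp.memℓp φ)
    rw [one_mul]
    refine lp.norm_le_of_tsum_le (by norm_num) (norm_nonneg _) ?_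
    change _ ≤ ‖φ‖ ^ (2 : ℝ≥0∞).toReal
    rw [lp.norm_rpow_eq_tsum (by norm_num) φ]
    exact tsum_comp_le_tsum_of_inj hφ (fun _ => by positivity) (Set.inclusion_injective h))

theorem restr_val {d L : ℕ} {X Y : Set (Fin d → ℤ)} (h : X ⊆ Y) (φ : L2 Y L) (n : X) :
    (restr L h φ).val n = φ.val (Set.inclusion h n) := rfl

/-- The phase factors of conjugation by the magnetic translation by `a`, for the magnetic field `B`
(trivial if `B = 0`): `(U(a) A U(a)^*)(n + a, m + a) = phase B a (n - m) • A(n, m)`. -/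
noncomputable def phase {d : ℕ} (B : Matrix (Fin d) (Fin d) ℝ) (a n : Fin d → ℤ) : ℂ :=
  Complex.exp (Complex.I / 2 * ((fun i => (a i : ℝ)) ⬝ᵥ B *ᵥ (fun i => (n i : ℝ)) : ℝ))

/-- Covariance `U(a) A_ω U(a)^* = A_{T^a ω}` under the (magnetic) translations by `a ∈ Γ`,
written out in matrix elements. -/
def IsCovariant {d L : ℕ} {X : Set (Fin d → ℤ)} {Ω : Type*} [AddAction (Fin d → ℤ) Ω]
    (B : Matrix (Fin d) (Fin d) ℝ) (Γ : AddSubgroup (Fin d → ℤ)) (A : Ω → Op X L) : Prop :=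
  ∀ a ∈ Γ, ∀ ω : Ω, ∀ n m n' m' : X,
    (n' : Fin d → ℤ) = a + n → (m' : Fin d → ℤ) = a + m →
    ∀ v, entry (A (a +ᵥ ω)) n' m' v = phase B a ((n : Fin d → ℤ) - m) • entry (A ω) n m v

/-- The matrix elements vanish at distance larger than some `R`, uniformly in `ω`. -/
def IsShortRange {d L : ℕ} {X : Set (Fin d → ℤ)} {Ω : Type*} (A : Ω → Op X L) : Prop :=
  ∃ R : ℝ, ∀ ω, ∀ n m : X, R < ‖(n : Fin d → ℤ) - m‖ → ∀ v, entry (A ω) n m v = 0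

/-- The matrix elements depend continuously on `ω`. -/
def HasContinuousEntries {d L : ℕ} {X : Set (Fin d → ℤ)} {Ω : Type*} [TopologicalSpace Ω]
    (A : Ω → Op X L) : Prop :=
  ∀ n m : X, ∀ v, Continuous fun ω => entry (A ω) n m v

/-! In dimension `d = p + 1` the last coordinate is the direction normal to the boundary. -/

/-- The half-space `ℤ^{d-1} × {1, 2, …}`. -/
def halfSpace (p : ℕ) : Set (Fin (p + 1) → ℤ) := {x | 1 ≤ x (Fin.last p)}

/-- The strip `ℤ^{d-1} × {1, …, N}`. -/
def strip (p N : ℕ) : Set (Fin (p + 1) → ℤ) := {x | 1 ≤ x (Fin.last p) ∧ x (Fin.last p) ≤ N}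

theorem strip_subset (p N : ℕ) : strip p N ⊆ halfSpace p := fun _ hx => hx.1

/-- The translations `ℤ^{d-1} × {0}` along the boundary. -/
def tangential (p : ℕ) : AddSubgroup (Fin (p + 1) → ℤ) where
  carrier := {a | a (Fin.last p) = 0}
  zero_mem' := rfl
  add_mem' := fun {a b} ha hb => by
    change a (Fin.last p) + b (Fin.last p) = 0
    rw [show a (Fin.last p) = 0 from ha, show b (Fin.last p) = 0 from hb, add_zero]
  neg_mem' := fun {a} ha => by
    change -a (Fin.last p) = 0
    rw [show a (Fin.last p) = 0 from ha, neg_zero]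

instance nontrivial_halfSpace (p L : ℕ) [NeZero L] : Nontrivial (L2 (halfSpace p) L) := by
  refine ⟨L2.single (⟨fun _ => 1, le_refl (1 : ℤ)⟩ : halfSpace p)
    (EuclideanSpace.single (0 : Fin L) (1 : ℂ)), 0, fun h => ?_⟩
  have := congrArg norm h
  rw [norm_zero] at this
  have h2 := lp.norm_single (E := fun _ : halfSpace p => EuclideanSpace ℂ (Fin L)) (p := 2)
    (by norm_num) (⟨fun _ => 1, le_refl (1 : ℤ)⟩ : halfSpace p)
    (EuclideanSpace.single (0 : Fin L) (1 : ℂ))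
  have h3 := h2.symm.trans this
  simp at h3

/-- The C⋆-algebra of all bounded families `(A_ω)` of half-space operators, with the supremum
norm and the pointwise operations. -/
abbrev HalfFamily (p L : ℕ) (Ω : Type*) : Type _ := lp (fun _ : Ω => Op (halfSpace p) L) ∞

/-- The edge algebra `ℰ_d`: the C⋆-algebra generated by the bounded families of half-space
operators with continuous entries that are covariant along the boundary, short range, and
supported in a strip `ℤ^{d-1} × {1, …, N}` for some `N`. -/
noncomputable def edgeAlgebra (p L : ℕ) [NeZero L] (Ω : Type*) [TopologicalSpace Ω]
    [AddAction (Fin (p + 1) → ℤ) Ω] (B : Matrix (Fin (p + 1)) (Fin (p + 1)) ℝ) :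
    NonUnitalStarSubalgebra ℂ (HalfFamily p L Ω) :=
  (NonUnitalStarAlgebra.adjoin ℂ {A : HalfFamily p L Ω |
    IsCovariant B (tangential p) (fun ω => A ω) ∧ IsShortRange (fun ω => A ω) ∧
    HasContinuousEntries (fun ω => A ω) ∧
    ∃ N : ℕ, ∀ ω, ∀ n m : halfSpace p, ((n : Fin (p + 1) → ℤ) ∉ strip p N ∨
      (m : Fin (p + 1) → ℤ) ∉ strip p N) → ∀ v, entry (A ω) n m v = 0}).topologicalClosure

/-- The unitization `ℰ_d^∼ = ℂ 1 + ℰ_d` of the edge algebra. Since the half-space is infinite in the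
normal direction, `1 ∉ ℰ_d`. By definition, `K₁(ℰ_d) = K₁(ℰ_d^∼)`. -/
noncomputable def edgeUnitization (p L : ℕ) [NeZero L] (Ω : Type*) [TopologicalSpace Ω]
    [AddAction (Fin (p + 1) → ℤ) Ω] (B : Matrix (Fin (p + 1)) (Fin (p + 1)) ℝ) :
    StarSubalgebra ℂ (HalfFamily p L Ω) :=
  StarAlgebra.adjoin ℂ (edgeAlgebra p L Ω B : Set (HalfFamily p L Ω))

instance isTopologicalRing_edgeUnitization (p L : ℕ) [NeZero L] (Ω : Type*) [TopologicalSpace Ω]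
    [AddAction (Fin (p + 1) → ℤ) Ω] (B : Matrix (Fin (p + 1)) (Fin (p + 1)) ℝ) :
    IsTopologicalRing (edgeUnitization p L Ω B) :=
  inferInstanceAs (IsTopologicalRing (edgeUnitization p L Ω B).toSubalgebra.toSubring)

/-- The half-space restriction `Ĥ` of an operator `H` on `ℓ²(ℤ^d, ℂ^L)`. -/
noncomputable def halfRestriction {p L : ℕ} (H : Op (Set.univ : Set (Fin (p + 1) → ℤ)) L) :
    Op (halfSpace p) L :=
  restr L (Set.subset_univ (halfSpace p)) ∘L H ∘L
    ContinuousLinearMap.adjoint (restr L (Set.subset_univ (halfSpace p)))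

/-- `Û = exp(2πi f(Ĥ))`. -/
noncomputable def expRep {p L : ℕ} (f : ℝ → ℝ) (Hhat : Op (halfSpace p) L) : Op (halfSpace p) L :=
  NormedSpace.exp ((2 * Real.pi * Complex.I : ℂ) • cfc f Hhat)

/-- `Π_{[1,N]}`, the restriction from the half-space to the strip of width `N`. -/
noncomputable def stripProj (p L N : ℕ) : L2 (halfSpace p) L →L[ℂ] L2 (strip p N) L :=
  restr L (strip_subset p N)

/-- `Ĝ^z_N = Π_{[1,N]} (Ĥ - z)⁻¹ Π_{[1,N]}^*`. -/
noncomputable def green {p L : ℕ} (N : ℕ) (Hhat : Op (halfSpace p) L) (z : ℂ) :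
    Op (strip p N) L :=
  stripProj p L N ∘L Ring.inverse (Hhat - z • (1 : Op (halfSpace p) L)) ∘L
    ContinuousLinearMap.adjoint (stripProj p L N)

/-- `(2 ε G - i)(2 ε G + i)⁻¹`. -/
noncomputable def cayley {p L N : ℕ} (ε : ℝ) (G : Op (strip p N) L) : Op (strip p N) L :=
  (((2 * ε : ℝ) : ℂ) • G - Complex.I • (1 : Op (strip p N) L)) *
    Ring.inverse (((2 * ε : ℝ) : ℂ) • G + Complex.I • (1 : Op (strip p N) L))

/-- The operator `C ⊕ 1` on the half-space, for an operator `C` on the strip. -/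
noncomputable def extendByOne {p L N : ℕ} (C : Op (strip p N) L) : Op (halfSpace p) L :=
  ContinuousLinearMap.adjoint (stripProj p L N) ∘L C ∘L stripProj p L N +
    (1 - ContinuousLinearMap.adjoint (stripProj p L N) ∘L stripProj p L N)

end TightBinding

/-! ### Classes of units in K₁ and their homotopy invariance -/

namespace KOne

/-! Write `W = (Ĥ - μ + iδ)(Ĥ - μ - iδ)⁻¹ = 1 + 2iδ(Ĥ - z)⁻¹` with `z = μ + iδ`. This unitary is
`exp(-2πi g₀(Ĥ))` with `g₀(x) = arctan((x - μ)/δ)/π + 1/2` (`div_eq_exp_arctan`). For small `δ` the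
function `g₀` is uniformly close to a continuous `g` that rises from 0 to 1 inside the gap
(`exists_switch_near`). Hence `W` is close to `exp(-2πi g(Ĥ))`, which is homotopic to `exp(-2πi
f(Ĥ)) = Û⁻¹` by interpolating linearly between `g` and `f`.

Let `P` be the projection onto the strip and `C = P(W - 1)P + 1`, that is, the compression of `W` to
the strip, extended by the identity. Away from `μ` the function `W - 1` is of order `δ`. Near `μ` it
is a function of `Ĥ` supported in the bulk gap, which decays into the half-space: approximate by a
polynomial `q`, and note that `q(Ĥ)` agrees with the compression of the small operator `q(H)` deep
in the half-space (`exists_aeval_toHalf_sub_single`, `exists_isLocal_near`). So `C` is close to `W`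
for a wide strip and small `δ` (`norm_truncation_sub_le`), and `[C] = -[Û]`.

On the strip, with `C_N` the compression of `W`, one has `2δG + i = i(2 - C_N)` and `2δG - i = -i
C_N`. The Cayley transform is therefore `-C_N(2 - C_N)⁻¹`, and its extension by the identity is `(1
- 2P) C (2 - C)⁻¹` (`extendByOne_cayley_mul`). Since `‖C‖ ≤ 1`, the factor `2 - C` is homotopic to 1
through `1 + t(1 - C)`, and `1 - 2P` through `1 + (e^{iπt} - 1)P`. Both have trivial class, so the
Cayley transform has the class of `C` (`KOne.exists_units_eq_neg`).

All homotopies must stay in the unitized edge algebra. For this, functions supported in the gap must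
vanish on every bulk Hamiltonian, which follows from the almost sure gap by full support and
continuity (`rcfc_eq_zero_of_ae_gap`). -/

theorem ofUnit_mul {R : Type*} [Ring R] [TopologicalSpace R] [IsTopologicalRing R] (u v : Rˣ) :
    ofUnit (u * v) = ofUnit u + ofUnit v := by
  have h := DirectLimit.mul_def (G := PiZeroGL R) (f := fun n m h => stab R n m h) 1
    (QuotientGroup.mk (Units.map (Matrix.scalar (Fin 1) : R →+* Matrix (Fin 1) (Fin 1) R).toMonoidHom u))
    (QuotientGroup.mk (Units.map (Matrix.scalar (Fin 1) : R →+* Matrix (Fin 1) (Fin 1) R).toMonoidHom v))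
  rw [← QuotientGroup.mk_mul, ← map_mul] at h
  exact congrArg Additive.ofMul h.symm

theorem ofUnit_eq_of_joined {R : Type*} [Ring R] [TopologicalSpace R] [IsTopologicalRing R]
    {u v : Rˣ} (h : Joined u v) : ofUnit u = ofUnit v := by
  have hc : Continuous (Units.map
      (Matrix.scalar (Fin 1) : R →+* Matrix (Fin 1) (Fin 1) R).toMonoidHom) := by
    apply Continuous.units_map
    change Continuous (fun r : R => Matrix.diagonal fun _ : Fin 1 => r)
    fun_prop
  have h1 : Joined (1 : Rˣ) (u⁻¹ * v) := by
    simpa using h.map (continuous_const_mul u⁻¹)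
  have h2 := h1.map hc
  rw [map_one] at h2
  unfold ofUnit
  congr 3
  rw [QuotientGroup.eq, ← map_inv, ← map_mul]
  exact h2

end KOne

/-- A path of invertible elements of a C⋆-algebra inside a closed unital C⋆-subalgebra joins
its endpoints in the group of units of the subalgebra. -/
theorem StarSubalgebra.joined_units {A : Type*} [CStarAlgebra A] (S : StarSubalgebra ℂ A)
    (hS : IsClosed (S : Set A)) {γ : ℝ → A} (hγ : Continuous γ) (hmem : ∀ t, γ t ∈ S)
    (hunit : ∀ t ∈ Set.Icc (0 : ℝ) 1, IsUnit (γ t)) {x y : Sˣ}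
    (hx : ((x : S) : A) = γ 0) (hy : ((y : S) : A) = γ 1) : Joined x y := by
  have := hS
  have : CompleteSpace S := hS.completeSpace_coe
  -- Spectral permanence: invertibility in the ambient algebra gives invertibility in the closed
  -- star subalgebra.
  have hu : ∀ t : unitInterval, IsUnit (⟨γ t, hmem t⟩ : S) := fun t =>
    (S.coe_isUnit).1 (hunit t t.2)
  refine ⟨⟨⟨fun t => (hu t).unit, ?_⟩, ?_, ?_⟩⟩
  -- In a complete normed ring the units carry the subspace topology, so the inverses need no
  -- separate continuity argument.
  · rw [Units.isOpenEmbedding_val.isEmbedding.continuous_iff]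
    exact (hγ.comp continuous_subtype_val).subtype_mk _
  · ext; simp [hx]
  · ext; simp [hy]

/-! ### Complex-valued functions of a selfadjoint element -/

/-- The continuous functional calculus of a selfadjoint element for complex-valued functions of a
real variable. -/
noncomputable def rcfc {A : Type*} [CStarAlgebra A] (F : ℝ → ℂ) (a : A) : A :=
  cfc (fun z : ℂ => F z.re) a

section rcfc

variable {A : Type*} [CStarAlgebra A] {a : A} {F G : ℝ → ℂ}

theorem rcfc_mul (hF : Continuous F) (hG : Continuous G) :
    rcfc (fun x => F x * G x) a = rcfc F a * rcfc G a :=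
  cfc_mul _ _ a (by fun_prop) (by fun_prop)

theorem rcfc_add (hF : Continuous F) (hG : Continuous G) :
    rcfc (fun x => F x + G x) a = rcfc F a + rcfc G a :=
  cfc_add a _ _ (by fun_prop) (by fun_prop)

theorem rcfc_sub (hF : Continuous F) (hG : Continuous G) :
    rcfc (fun x => F x - G x) a = rcfc F a - rcfc G a :=
  cfc_sub _ _ a (by fun_prop) (by fun_prop)

theorem rcfc_const_mul (c : ℂ) (hF : Continuous F) :
    rcfc (fun x => c * F x) a = c • rcfc F a :=
  cfc_const_mul c _ a (by fun_prop)

theorem rcfc_one (ha : IsSelfAdjoint a) : rcfc (fun _ => 1) a = 1 :=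
  cfc_const_one ℂ a

theorem rcfc_const (c : ℂ) (ha : IsSelfAdjoint a) : rcfc (fun _ => c) a = c • 1 := by
  rw [← Algebra.algebraMap_eq_smul_one]
  exact cfc_const c a

theorem IsSelfAdjoint.re_of_mem_spectrum (ha : IsSelfAdjoint a) {z : ℂ} (hz : z ∈ spectrum ℂ a) :
    ((z.re : ℝ) : ℂ) = z :=
  (ha.mem_spectrum_eq_re hz).symm

/-- The spectrum is real, so the precomposition with the real part in `rcfc` is invisible on it. -/
theorem rcfc_ofReal (ha : IsSelfAdjoint a) : rcfc (fun x => (x : ℂ)) a = a := by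
  have : rcfc (fun x => (x : ℂ)) a = cfc (id : ℂ → ℂ) a :=
    cfc_congr fun z hz => ha.re_of_mem_spectrum hz
  rw [this, cfc_id ℂ a]

theorem norm_rcfc_le {c : ℝ} (hc : 0 ≤ c) (h : ∀ x, ‖F x‖ ≤ c) : ‖rcfc F a‖ ≤ c :=
  norm_cfc_le hc fun _ _ => h _

theorem rcfc_comp_ofReal (ha : IsSelfAdjoint a) (f : ℝ → ℝ) :
    rcfc (fun x => (f x : ℂ)) a = cfc f a := by
  rw [cfc_real_eq_complex f ha]
  rfl

theorem exp_rcfc (ha : IsSelfAdjoint a) (hF : Continuous F) :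
    NormedSpace.exp (rcfc F a) = rcfc (fun x => Complex.exp (F x)) a := by
  have hn : IsStarNormal (rcfc F a) := cfc_predicate _ a
  rw [← CFC.complex_exp_eq_normedSpace_exp (a := rcfc F a) hn]
  exact (cfc_comp' Complex.exp (fun z : ℂ => F z.re) a (by fun_prop) (by fun_prop)).symm

theorem exp_smul_cfc (ha : IsSelfAdjoint a) {f : ℝ → ℝ} (hf : Continuous f) (c : ℂ) :
    NormedSpace.exp (c • cfc f a) = rcfc (fun x => Complex.exp (c * f x)) a := by
  rw [← rcfc_comp_ofReal ha f, ← rcfc_const_mul c (by fun_prop), exp_rcfc ha (by fun_prop)]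

theorem map_rcfc {B : Type*} [CStarAlgebra B] (φ : A →⋆ₐ[ℂ] B) (hφ : Continuous φ)
    (ha : IsSelfAdjoint a) (hF : Continuous F) : φ (rcfc F a) = rcfc F (φ a) := by
  have h1 : IsStarNormal a := ha.isStarNormal
  have h2 : IsStarNormal (φ a) := (ha.map φ).isStarNormal
  exact StarAlgHom.map_cfc φ (fun z : ℂ => F z.re) a (by fun_prop) hφ h1 h2

end rcfc

/-- A continuous function of a selfadjoint element is a limit of polynomials, uniformly over all
selfadjoint elements of bounded norm. -/
theorem exists_polynomial_near_rcfc {F : ℝ → ℂ} (hF : Continuous F) (M : ℝ) {ε : ℝ} (hε : 0 < ε) :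
    ∃ q : Polynomial ℂ, ∀ (A : Type*) [CStarAlgebra A] (a : A), IsSelfAdjoint a → ‖a‖ ≤ M →
      ‖rcfc F a - Polynomial.aeval a q‖ ≤ ε := by
  -- Weierstrass for the real and imaginary parts separately, with half the error each, on an
  -- interval containing the spectrum of every selfadjoint element of norm at most `M`.
  obtain ⟨p₁, h₁⟩ := exists_polynomial_near_of_continuousOn (-M) M (fun x => (F x).re)
    (by fun_prop) (ε / 2) (by positivity)
  obtain ⟨p₂, h₂⟩ := exists_polynomial_near_of_continuousOn (-M) M (fun x => (F x).im)
    (by fun_prop) (ε / 2) (by positivity)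
  refine ⟨p₁.map Complex.ofRealHom + Polynomial.C Complex.I * p₂.map Complex.ofRealHom, ?_⟩
  intro A _ a ha hM
  rcases subsingleton_or_nontrivial A with _ | _
  · rw [Subsingleton.elim (_ - _) (0 : A), norm_zero]
    exact hε.le
  have hn : IsStarNormal a := ha.isStarNormal
  rw [← cfc_polynomial _ a, rcfc, ← cfc_sub _ _ a (by fun_prop) (by fun_prop)]
  refine norm_cfc_le hε.le fun z hz => ?_
  have hz1 := ha.re_of_mem_spectrum hz
  have hz2 : z.re ∈ Set.Icc (-M) M := by
    have : |z.re| ≤ M := (Complex.abs_re_le_norm z).trans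
      ((spectrum.norm_le_norm_of_mem hz).trans hM)
    exact abs_le.1 this
  have e1 := h₁ _ hz2
  have e2 := h₂ _ hz2
  set x := z.re
  rw [← hz1]
  have : F x - Polynomial.eval (x : ℂ) (p₁.map Complex.ofRealHom +
      Polynomial.C Complex.I * p₂.map Complex.ofRealHom)
      = -(((p₁.eval x - (F x).re : ℝ) : ℂ)) - Complex.I * ((p₂.eval x - (F x).im : ℝ) : ℂ) := by
    have e3 : ∀ p : Polynomial ℝ, Polynomial.eval (x : ℂ) (Polynomial.map Complex.ofRealHom p)
        = ((p.eval x : ℝ) : ℂ) := fun p => Polynomial.eval_map_apply Complex.ofRealHom x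
    simp only [Polynomial.eval_add, Polynomial.eval_mul, Polynomial.eval_C, e3]
    conv_lhs => rw [← Complex.re_add_im (F x)]
    push_cast
    ring
  rw [this]
  refine (norm_sub_le _ _).trans ?_
  rw [norm_neg, norm_mul, Complex.norm_I, one_mul, Complex.norm_real, Complex.norm_real,
    Real.norm_eq_abs, Real.norm_eq_abs]
  linarith

theorem isUnit_sub_of_norm_lt {A : Type*} [CStarAlgebra A] {x : A} {k : ℝ}
    (h : ‖x‖ < k) : IsUnit (((k : ℝ) : ℂ) • (1 : A) - x) := by
  nontriviality A
  rw [← Algebra.algebraMap_eq_smul_one]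
  have := spectrum.mem_resolventSet_of_norm_lt (𝕜 := ℂ) (a := x) (k := (k : ℂ))
    (by rw [Complex.norm_real]; exact h.trans_le (le_abs_self k))
  exact this

theorem exp_mul_exp_neg {A : Type*} [CStarAlgebra A] (x : A) :
    NormedSpace.exp x * NormedSpace.exp (-x) = 1 := by
  let _ : NormedAlgebra ℚ A := .restrictScalars ℚ ℂ A
  rw [← NormedSpace.exp_add_of_commute (Commute.refl x).neg_right, add_neg_cancel,
    NormedSpace.exp_zero]

theorem continuous_exp_cstar {A : Type*} [CStarAlgebra A] :
    Continuous (NormedSpace.exp : A → A) := by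
  let _ : NormedAlgebra ℚ A := .restrictScalars ℚ ℂ A
  exact NormedSpace.exp_continuous

theorem isUnit_exp_cstar {A : Type*} [CStarAlgebra A] (x : A) : IsUnit (NormedSpace.exp x) :=
  ⟨⟨_, _, exp_mul_exp_neg x, by simpa using exp_mul_exp_neg (-x)⟩, rfl⟩

/-! ### The homotopies, in an abstract C⋆-algebra -/

section edge

variable {A : Type*} [CStarAlgebra A] {S : StarSubalgebra ℂ A} {h : A} {a b : ℝ}

/-- `exp (2πi F(h))` lies in a unital subalgebra containing all functions of `h` supported in
`(a, b)`, if `F` is integer-valued outside `(a, b)`. -/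
theorem exp_smul_cfc_mem (ha : IsSelfAdjoint h)
    (hE : ∀ F : ℝ → ℂ, Continuous F → (∀ x ∉ Set.Ioo a b, F x = 0) → rcfc F h ∈ S)
    {F : ℝ → ℝ} (hF : Continuous F) (c : ℂ)
    (hF1 : ∀ x ∉ Set.Ioo a b, Complex.exp (c * F x) = 1) :
    NormedSpace.exp (c • cfc F h) ∈ S := by
  -- Subtracting 1 from the exponential makes it vanish outside the interval; the unit is added back
  -- at the end.
  have h1 := hE (fun x => Complex.exp (c * F x) - 1) (by fun_prop)
    (fun x hx => by rw [hF1 x hx, sub_self])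
  rw [rcfc_sub (by fun_prop) (by fun_prop), rcfc_one ha, ← exp_smul_cfc ha hF] at h1
  simpa using add_mem h1 (one_mem S)

theorem exp_two_pi_eq_one {F : ℝ → ℝ} (h0 : ∀ x ≤ a, F x = 0) (h1 : ∀ x, b ≤ x → F x = 1)
    {c : ℂ} (hc : Complex.exp c = 1) :
    ∀ x ∉ Set.Ioo a b, Complex.exp (c * F x) = 1 := by
  intro x hx
  rw [Set.mem_Ioo, not_and_or, not_lt, not_lt] at hx
  rcases hx with hx | hx
  · simp [h0 x hx]
  · simp [h1 x hx, hc]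

/-- If the contraction `C` is close to `exp (-2πi g(h))`, then the invertible element
`(1 - 2P) C (2 - C)⁻¹` represents the class of `exp (-2πi f(h))`. -/
theorem KOne.exists_units_eq_neg (hS : IsClosed (S : Set A)) (ha : IsSelfAdjoint h)
    (hE : ∀ F : ℝ → ℂ, Continuous F → (∀ x ∉ Set.Ioo a b, F x = 0) → rcfc F h ∈ S)
    {f g : ℝ → ℝ} (hf : Continuous f) (hg : Continuous g)
    (hf0 : ∀ x ≤ a, f x = 0) (hf1 : ∀ x, b ≤ x → f x = 1)
    (hg0 : ∀ x ≤ a, g x = 0) (hg1 : ∀ x, b ≤ x → g x = 1)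
    {P C : A} (hPP : P * P = P) (hPS : P ∈ S) (hCS : C ∈ S) (hC : ‖C‖ ≤ 1)
    (hnear : ‖C - rcfc (fun x => Complex.exp (-(2 * Real.pi * Complex.I) * g x)) h‖ < 1) :
    ∃ u v : Sˣ, ((u : S) : A) = rcfc (fun x => Complex.exp (2 * Real.pi * Complex.I * f x)) h ∧
      ((v : S) : A) * ((2 : ℂ) • 1 - C) = (1 - (2 : ℂ) • P) * C ∧
      KOne.ofUnit u = -KOne.ofUnit v := by
  have := hS
  rw [← exp_smul_cfc ha hg] at hnear
  have hexp1 : Complex.exp (2 * Real.pi * Complex.I) = 1 := Complex.exp_two_pi_mul_I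
  have hexp2 : Complex.exp (-(2 * Real.pi * Complex.I)) = 1 := by
    rw [Complex.exp_neg, hexp1, inv_one]
  set e : ℂ := 2 * Real.pi * Complex.I with he
  set W := NormedSpace.exp ((-e) • cfc g h) with hW
  set W' := NormedSpace.exp (e • cfc g h) with hW'
  have mk : ∀ x ∈ S, IsUnit x → ∃ y : Sˣ, ((y : S) : A) = x := fun x hx hx' =>
    ⟨(S.coe_isUnit (a := ⟨x, hx⟩).1 hx').unit, rfl⟩
  have hWW : W' * W = 1 := by
    rw [hW, hW', neg_smul, exp_mul_exp_neg]
  have hWW2 : W * W' = 1 := by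
    rw [hW, hW', neg_smul]
    simpa using exp_mul_exp_neg (-(e • cfc g h))
  have hW'n : ‖W'‖ ≤ 1 := by
    rw [hW', exp_smul_cfc ha hg]
    refine norm_rcfc_le zero_le_one fun x => ?_
    rw [he, show (2 * Real.pi * Complex.I * g x : ℂ) = ((2 * Real.pi * g x : ℝ) : ℂ) * Complex.I by
      push_cast; ring, Complex.norm_exp_ofReal_mul_I]
  have hWS : W ∈ S := exp_smul_cfc_mem ha hE hg _ (exp_two_pi_eq_one hg0 hg1 hexp2)
  -- the units
  obtain ⟨u, hu⟩ := mk _ (exp_smul_cfc_mem ha hE hf e (exp_two_pi_eq_one hf0 hf1 hexp1))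
    (isUnit_exp_cstar _)
  obtain ⟨u', hu'⟩ := mk _ (exp_smul_cfc_mem ha hE hf (-e) (exp_two_pi_eq_one hf0 hf1 hexp2))
    (isUnit_exp_cstar _)
  have huu' : u' = u⁻¹ := by
    rw [eq_inv_iff_mul_eq_one]
    ext
    push_cast
    rw [hu, hu', neg_smul]
    simpa using exp_mul_exp_neg (-(e • cfc f h))
  obtain ⟨w, hw⟩ := mk W hWS (isUnit_exp_cstar _)
  have hpathC : ∀ t ∈ Set.Icc (0 : ℝ) 1, IsUnit (W + (t : ℂ) • (C - W)) := by
    intro t ht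
    -- Factoring out the unitary `W` leaves a Neumann series, since `‖C - W‖ < 1`.
    have h1 : W + (t : ℂ) • (C - W) = W * (((1 : ℝ) : ℂ) • 1 - (-((t : ℂ) • (W' * (C - W))))) := by
      rw [sub_neg_eq_add, mul_add, mul_smul_comm (t : ℂ) W, ← mul_assoc, hWW2]
      simp
    rw [h1]
    refine (isUnit_exp_cstar _).mul (isUnit_sub_of_norm_lt ?_)
    rw [norm_neg, norm_smul, Complex.norm_real, Real.norm_of_nonneg ht.1]
    have h2 : ‖W' * (C - W)‖ < 1 := (norm_mul_le _ _).trans_lt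
      ((mul_le_of_le_one_left (norm_nonneg _) hW'n).trans_lt hnear)
    nlinarith [norm_nonneg (W' * (C - W)), ht.1, ht.2]
  obtain ⟨c, hc⟩ := mk C hCS (by simpa using hpathC 1 (by simp))
  have hpathD : ∀ t ∈ Set.Icc (0 : ℝ) 1, IsUnit ((1 : A) + (t : ℂ) • (1 - C)) := by
    intro t ht
    -- Invertible because `‖tC‖ ≤ t < 1 + t`; at `t = 1` this is `2 - C`.
    have h1 : (1 : A) + (t : ℂ) • (1 - C) = ((1 + t : ℝ) : ℂ) • 1 - (t : ℂ) • C := by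
      push_cast; module
    rw [h1]
    refine isUnit_sub_of_norm_lt ?_
    rw [norm_smul, Complex.norm_real, Real.norm_of_nonneg ht.1]
    nlinarith [ht.1]
  have hDS : ∀ t : ℂ, (1 : A) + t • (1 - C) ∈ S := fun t =>
    add_mem (one_mem S) (S.smul_mem (sub_mem (one_mem S) hCS) t)
  obtain ⟨d, hd⟩ := mk _ (hDS 1) (by simpa using hpathD 1 (by simp))
  -- For idempotent `P` this element is `exp(zP)`, with inverse obtained from `-z`; `z = πi` gives
  -- `1 - 2P`.
  have hpathPP : ∀ z : ℂ, IsUnit ((1 : A) + (Complex.exp z - 1) • P) := by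
    intro z
    have key : ∀ z : ℂ, ((1 : A) + (Complex.exp z - 1) • P) * (1 + (Complex.exp (-z) - 1) • P) = 1 := by
      intro z
      have : Complex.exp z * Complex.exp (-z) = 1 := by rw [← Complex.exp_add]; simp
      simp only [mul_add, add_mul, smul_mul_smul_comm, hPP, mul_one, one_mul]
      have h3 : (Complex.exp z - 1) * (Complex.exp (-z) - 1)
          = -(Complex.exp z - 1) - (Complex.exp (-z) - 1) := by linear_combination this
      rw [h3]
      module
    exact ⟨⟨_, _, key z, by simpa using key (-z)⟩, rfl⟩
  have hPSz : ∀ z : ℂ, (1 : A) + (Complex.exp z - 1) • P ∈ S := fun z =>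
    add_mem (one_mem S) (S.smul_mem hPS _)
  obtain ⟨s, hs⟩ := mk _ (hPSz (Real.pi * Complex.I)) (hpathPP _)
  -- the homotopies
  have js : KOne.ofUnit (1 : Sˣ) = KOne.ofUnit s := by
    refine KOne.ofUnit_eq_of_joined (S.joined_units hS
      (γ := fun t : ℝ => (1 : A) + (Complex.exp (t * (Real.pi * Complex.I)) - 1) • P)
      (by fun_prop) (fun t => hPSz _) (fun t _ => hpathPP _) ?_ ?_)
    · simp
    · simp [hs]
  have jd : KOne.ofUnit (1 : Sˣ) = KOne.ofUnit d := by
    refine KOne.ofUnit_eq_of_joined (S.joined_units hS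
      (γ := fun t : ℝ => (1 : A) + (t : ℂ) • (1 - C))
      (by fun_prop) (fun t => hDS _) (fun t ht => hpathD t ht) ?_ ?_)
    · simp
    · simp [hd]
  have jw : KOne.ofUnit w = KOne.ofUnit c := by
    refine KOne.ofUnit_eq_of_joined (S.joined_units hS
      (γ := fun t : ℝ => W + (t : ℂ) • (C - W))
      (by fun_prop) (fun t => add_mem hWS (S.smul_mem (sub_mem hCS hWS) _))
      (fun t ht => hpathC t ht) ?_ ?_)
    · simp [hw]
    · simp [hc]
  have ju : KOne.ofUnit w = KOne.ofUnit u' := by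
    -- A convex combination of `g` and `f` is again 0 to the left and 1 to the right of the gap, so
    -- its exponential stays in `S`.
    have hcomb : ∀ t : ℝ, NormedSpace.exp ((-e) • (((1 - t : ℝ) : ℂ) • cfc g h + (t : ℂ) • cfc f h))
        = NormedSpace.exp ((-e) • cfc (fun x => (1 - t) * g x + t * f x) h) := by
      intro t
      rw [cfc_add h (fun x => (1 - t) * g x) (fun x => t * f x) (by fun_prop) (by fun_prop),
        cfc_const_mul _ _ h (by fun_prop), cfc_const_mul _ _ h (by fun_prop)]
      simp only [Complex.coe_smul]
    refine KOne.ofUnit_eq_of_joined (S.joined_units hS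
      (γ := fun t : ℝ =>
        NormedSpace.exp ((-e) • (((1 - t : ℝ) : ℂ) • cfc g h + (t : ℂ) • cfc f h)))
      ?_ (fun t => ?_) (fun t ht => isUnit_exp_cstar _) ?_ ?_)
    · refine continuous_exp_cstar.comp ?_
      fun_prop
    · rw [hcomb]
      refine exp_smul_cfc_mem ha hE (by fun_prop) _ (exp_two_pi_eq_one ?_ ?_ hexp2)
      · intro x hx; simp [hf0 x hx, hg0 x hx]
      · intro x hx; simp [hf1 x hx, hg1 x hx]
    · simp [hw, hW]
    · simp [hu']
  have hone : KOne.ofUnit (1 : Sˣ) = 0 := by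
    have := KOne.ofUnit_mul (1 : Sˣ) 1
    rw [mul_one] at this
    simpa using this
  refine ⟨u, s * c * d⁻¹, hu.trans (exp_smul_cfc ha hf _), ?_, ?_⟩
  · have h1 : ((d : S) : A) = (2 : ℂ) • 1 - C := by rw [hd]; module
    have h2 : ((s : S) : A) = 1 - (2 : ℂ) • P := by
      rw [hs, Complex.exp_pi_mul_I]; module
    rw [← h1, ← h2, ← hc]
    norm_cast
    simp
  · have h3 : KOne.ofUnit u + KOne.ofUnit u' = 0 := by
      rw [← KOne.ofUnit_mul, huu', mul_inv_cancel, hone]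
    have h4 : KOne.ofUnit d + KOne.ofUnit d⁻¹ = 0 := by
      rw [← KOne.ofUnit_mul, mul_inv_cancel, hone]
    have h5 : KOne.ofUnit d⁻¹ = (0 : KOne S) := by
      rwa [← jd, hone, zero_add] at h4
    -- The outer two classes vanish, so no commutativity of K₁ is needed: `[s c d⁻¹] = [c] = [w] =
    -- [u']`, and `u' = u⁻¹`.
    rw [KOne.ofUnit_mul, KOne.ofUnit_mul, h5, ← js, hone, zero_add, add_zero, ← jw, ju]
    exact eq_neg_of_add_eq_zero_left h3

end edge

/-- The unitization of a closed nonunital star subalgebra is closed. -/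
theorem NonUnitalStarSubalgebra.isClosed_adjoin {A : Type*} [CStarAlgebra A]
    {s : NonUnitalStarSubalgebra ℂ A} (hs : IsClosed (s : Set A)) :
    IsClosed (StarAlgebra.adjoin ℂ (s : Set A) : Set A) := by
  -- The unitization is the sum of a closed subspace and the line spanned by 1, and adding a
  -- finite-dimensional subspace preserves closedness.
  have h1 : (StarAlgebra.adjoin ℂ (s : Set A) : Set A) =
      (s.toSubmodule ⊔ Submodule.span ℂ {(1 : A)} : Submodule ℂ A) := by
    ext x
    rw [SetLike.mem_coe, SetLike.mem_coe, Submodule.mem_sup]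
    constructor
    · intro hx
      rw [← NonUnitalStarSubalgebra.unitization_range s] at hx
      obtain ⟨y, rfl⟩ := hx
      refine ⟨(y.snd : A), y.snd.2, y.fst • 1,
        Submodule.smul_mem _ _ (Submodule.mem_span_singleton_self _), ?_⟩
      rw [← Algebra.algebraMap_eq_smul_one, add_comm]
      rfl
    · rintro ⟨y, hy, z, hz, rfl⟩
      obtain ⟨c, rfl⟩ := Submodule.mem_span_singleton.1 hz
      exact add_mem (StarAlgebra.subset_adjoin ℂ _ hy)
        ((StarAlgebra.adjoin ℂ (s : Set A)).smul_mem (one_mem _) c)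
  rw [h1]
  exact Submodule.isClosed_sup_finiteDimensional _ _ hs

/-! ### Scalar estimates: symbol, switch function and cutoff -/

theorem sub_mul_I_ne_zero (s : ℝ) {δ : ℝ} (hδ : δ ≠ 0) : (s : ℂ) - δ * Complex.I ≠ 0 := by
  intro h
  have := congrArg Complex.im h
  simp at this
  exact hδ this

theorem abs_le_norm_sub_mul_I (s δ : ℝ) : |s| ≤ ‖(s : ℂ) - δ * Complex.I‖ := by
  simpa using Complex.abs_re_le_norm ((s : ℂ) - δ * Complex.I)

/-- The unimodular symbol `(s + iδ)/(s - iδ)` as an exponential. -/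
theorem div_eq_exp_arctan (s : ℝ) {δ : ℝ} (hδ : 0 < δ) :
    ((s : ℂ) + δ * Complex.I) / ((s : ℂ) - δ * Complex.I) =
      Complex.exp (-(2 * Real.pi * Complex.I) * ((Real.arctan (s / δ) / Real.pi + 1 / 2 : ℝ) : ℂ)) := by
  have hne := sub_mul_I_ne_zero s hδ.ne'
  set t := s / δ with ht
  have hs : s = t * δ := by rw [ht]; field_simp
  set θ := Real.arctan t
  have hc : 0 < Real.cos θ := Real.cos_arctan_pos t
  have htan : Real.sin θ = t * Real.cos θ := by
    have := Real.tan_arctan t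
    rw [Real.tan_eq_sin_div_cos, div_eq_iff hc.ne'] at this
    exact this
  have e1 : -(2 * Real.pi * Complex.I) * ((θ / Real.pi + 1 / 2 : ℝ) : ℂ)
      = ((-θ : ℝ) : ℂ) * Complex.I + ((-θ : ℝ) : ℂ) * Complex.I - Real.pi * Complex.I := by
    have : (Real.pi : ℂ) ≠ 0 := by exact_mod_cast Real.pi_ne_zero
    push_cast
    field_simp
    ring
  rw [e1, Complex.exp_sub, Complex.exp_pi_mul_I, Complex.exp_add, Complex.exp_mul_I,
    ← Complex.ofReal_cos, ← Complex.ofReal_sin, Real.cos_neg, Real.sin_neg, htan, div_eq_iff hne]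
  -- With `k = cos θ` the claim reduces to `k²(t + i)²(t - i) = t + i`, which is `k²(1 + t²) = 1`.
  have h1 : (1 + (t : ℂ) ^ 2) * (Real.cos θ : ℂ) ^ 2 = 1 := by
    have := Real.sin_sq_add_cos_sq θ
    rw [htan] at this
    have h2 : (1 + t ^ 2) * Real.cos θ ^ 2 = 1 := by linarith
    exact_mod_cast h2
  rw [hs]
  generalize Real.cos θ = k at h1 ⊢
  push_cast
  linear_combination (δ : ℂ) * (-(t : ℂ) - Complex.I) * h1 +
    (δ : ℂ) * (k : ℂ) ^ 2 * ((t : ℂ) ^ 3 + 2 * t - (t : ℂ) ^ 2 * Complex.I) * Complex.I_sq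

theorem norm_exp_sub_exp_le (x y : ℝ) :
    ‖Complex.exp (-(2 * Real.pi * Complex.I) * x) - Complex.exp (-(2 * Real.pi * Complex.I) * y)‖
      ≤ 2 * Real.pi * |x - y| := by
  have h1 : Complex.exp (-(2 * Real.pi * Complex.I) * x)
        - Complex.exp (-(2 * Real.pi * Complex.I) * y)
      = Complex.exp (((-(2 * Real.pi * y) : ℝ) : ℂ) * Complex.I)
        * (Complex.exp (Complex.I * ((-(2 * Real.pi * (x - y)) : ℝ) : ℂ)) - 1) := by
    rw [mul_sub, ← Complex.exp_add, mul_one]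
    congr 2
    · push_cast; ring
    · push_cast; ring
  rw [h1, norm_mul, Complex.norm_exp_ofReal_mul_I, one_mul]
  refine (Real.norm_exp_I_mul_ofReal_sub_one_le).trans (le_of_eq ?_)
  rw [norm_neg, norm_mul, Real.norm_of_nonneg (by positivity), Real.norm_eq_abs]

/-- The symbol `(x - μ + iδ)/(x - μ - iδ)` is close to `exp (-2πi g(x))` for a function `g` rising
from `0` to `1` inside a given interval around `μ`, if `δ` is small. -/
theorem exists_switch_near {a b μ : ℝ} (hμ : μ ∈ Set.Ioo a b) :
    ∃ δ₀ : ℝ, 0 < δ₀ ∧ ∀ δ : ℝ, 0 < δ → δ < δ₀ → ∃ g : ℝ → ℝ, Continuous g ∧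
      (∀ x ≤ a, g x = 0) ∧ (∀ x, b ≤ x → g x = 1) ∧
      ∀ x : ℝ, ‖(((x - μ : ℝ) : ℂ) + δ * Complex.I) / (((x - μ : ℝ) : ℂ) - δ * Complex.I)
        - Complex.exp (-(2 * Real.pi * Complex.I) * g x)‖ ≤ 1 / 4 := by
  -- Beyond `S` the arctangent is within `π/40` of its limit, so `g₀` is within `1/40` of 0 or 1
  -- outside the gap as soon as `δS` is less than the distance from `μ` to the gap edges.
  obtain ⟨S₁, hS₁⟩ := Filter.eventually_atTop.1 ((Real.tendsto_arctan_atTop.mono_right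
    nhdsWithin_le_nhds).eventually (lt_mem_nhds
    (show Real.pi / 2 - Real.pi / 40 < Real.pi / 2 by linarith [Real.pi_pos])))
  set S := max S₁ 1
  have hS0 : 0 < S := lt_of_lt_of_le one_pos (le_max_right _ _)
  have hS : ∀ s, S ≤ s → Real.pi / 2 - Real.pi / 40 < Real.arctan s :=
    fun s hs => hS₁ s ((le_max_left _ _).trans hs)
  refine ⟨min (μ - a) (b - μ) / S, div_pos (lt_min (by linarith [hμ.1]) (by linarith [hμ.2])) hS0, ?_⟩
  intro δ hδ hδ₀
  rw [lt_div_iff₀ hS0] at hδ₀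
  have ha : δ * S < μ - a := hδ₀.trans_le (min_le_left _ _)
  have hb : δ * S < b - μ := hδ₀.trans_le (min_le_right _ _)
  set g₀ : ℝ → ℝ := fun x => Real.arctan ((x - μ) / δ) / Real.pi + 1 / 2 with hg₀
  have hpi := Real.pi_pos
  have h01 : ∀ x, 0 ≤ g₀ x ∧ g₀ x ≤ 1 := by
    intro x
    have h1 := Real.neg_pi_div_two_lt_arctan ((x - μ) / δ)
    have h2 := Real.arctan_lt_pi_div_two ((x - μ) / δ)
    constructor
    · have : -(1 / 2) ≤ Real.arctan ((x - μ) / δ) / Real.pi := by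
        rw [le_div_iff₀ hpi]; linarith
      simp only [hg₀]; linarith
    · have : Real.arctan ((x - μ) / δ) / Real.pi ≤ 1 / 2 := by
        rw [div_le_iff₀ hpi]; linarith
      simp only [hg₀]; linarith
  have hlow : ∀ x ≤ a, g₀ x ≤ 1 / 40 := by
    intro x hx
    have h1 : S ≤ -((x - μ) / δ) := by
      rw [← neg_div, le_div_iff₀ hδ]; linarith
    have h2 := hS _ h1
    rw [Real.arctan_neg] at h2
    have : Real.arctan ((x - μ) / δ) / Real.pi ≤ -(1 / 2) + 1 / 40 := by
      rw [div_le_iff₀ hpi]; linarith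
    simp only [hg₀]; linarith
  have hhigh : ∀ x, b ≤ x → 1 - 1 / 40 ≤ g₀ x := by
    intro x hx
    have h1 : S ≤ (x - μ) / δ := by
      rw [le_div_iff₀ hδ]; linarith
    have h2 := hS _ h1
    have : 1 / 2 - 1 / 40 ≤ Real.arctan ((x - μ) / δ) / Real.pi := by
      rw [le_div_iff₀ hpi]; linarith
    simp only [hg₀]; linarith
  -- The affine map taking `[1/40, 39/40]` onto `[0, 1]`, clamped: it makes the tails exact and
  -- moves values by at most `1/38`, and `2π/38 < 1/4`.
  refine ⟨fun x => max 0 (min 1 ((g₀ x - 1 / 40) / (38 / 40))), ?_, ?_, ?_, ?_⟩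
  · have : Continuous g₀ := by
      have := Real.continuous_arctan
      fun_prop
    fun_prop
  · intro x hx
    refine max_eq_left ((min_le_right _ _).trans ?_)
    have := hlow x hx
    exact div_nonpos_of_nonpos_of_nonneg (by linarith) (by norm_num)
  · intro x hx
    have := hhigh x hx
    have h1 : min 1 ((g₀ x - 1 / 40) / (38 / 40)) = 1 :=
      min_eq_left (by rw [le_div_iff₀ (by norm_num)]; linarith)
    change max 0 (min 1 ((g₀ x - 1 / 40) / (38 / 40))) = 1
    rw [h1]
    exact max_eq_right zero_le_one
  · intro x
    rw [div_eq_exp_arctan _ hδ]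
    refine (norm_exp_sub_exp_le (g₀ x) _).trans ?_
    have h1 := h01 x
    have h2 : |g₀ x - max 0 (min 1 ((g₀ x - 1 / 40) / (38 / 40)))| ≤ 1 / 38 := by
      rw [abs_le]
      constructor
      · rcases max_cases 0 (min 1 ((g₀ x - 1 / 40) / (38 / 40))) with h | h <;>
        rcases min_cases 1 ((g₀ x - 1 / 40) / (38 / 40)) with h' | h' <;>
        linarith
      · rcases max_cases 0 (min 1 ((g₀ x - 1 / 40) / (38 / 40))) with h | h <;>
        rcases min_cases 1 ((g₀ x - 1 / 40) / (38 / 40)) with h' | h' <;>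
        linarith
    have h3 := Real.pi_lt_d2
    nlinarith [abs_nonneg (g₀ x - max 0 (min 1 ((g₀ x - 1 / 40) / (38 / 40))))]

/-- A continuous cutoff function near `μ`. -/
theorem exists_cutoff {a b μ : ℝ} (hμ : μ ∈ Set.Ioo a b) :
    ∃ χ : ℝ → ℂ, ∃ c : ℝ, 0 < c ∧ Continuous χ ∧ (∀ x ∉ Set.Ioo a b, χ x = 0) ∧
      (∀ x, |x - μ| ≤ c → χ x = 1) ∧ ∀ x, ‖1 - χ x‖ ≤ 1 := by
  -- Half the distance to the gap edges, so that a trapezoid equal to 1 up to distance `c` and 0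
  -- from distance `2c` fits into the gap.
  set c := min (μ - a) (b - μ) / 2 with hc
  have hc0 : 0 < c := half_pos (lt_min (by linarith [hμ.1]) (by linarith [hμ.2]))
  have hca : 2 * c ≤ μ - a := by rw [hc]; linarith [min_le_left (μ - a) (b - μ)]
  have hcb : 2 * c ≤ b - μ := by rw [hc]; linarith [min_le_right (μ - a) (b - μ)]
  refine ⟨fun x => ((max 0 (min 1 (2 - |x - μ| / c)) : ℝ) : ℂ), c, hc0, by fun_prop, ?_, ?_, ?_⟩
  · intro x hx
    have h1 : 2 * c ≤ |x - μ| := by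
      rw [Set.mem_Ioo, not_and_or, not_lt, not_lt] at hx
      rcases hx with hx | hx
      · linarith [neg_abs_le (x - μ)]
      · linarith [le_abs_self (x - μ)]
    have h2 : 2 ≤ |x - μ| / c := by rwa [le_div_iff₀ hc0]
    change ((max 0 (min 1 (2 - |x - μ| / c)) : ℝ) : ℂ) = 0
    rw [max_eq_left ((min_le_right _ _).trans (by linarith)), Complex.ofReal_zero]
  · intro x hx
    have h2 : |x - μ| / c ≤ 1 := by rwa [div_le_one hc0]
    change ((max 0 (min 1 (2 - |x - μ| / c)) : ℝ) : ℂ) = 1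
    rw [min_eq_left (by linarith), max_eq_right zero_le_one, Complex.ofReal_one]
  · intro x
    rw [← Complex.ofReal_one, ← Complex.ofReal_sub, Complex.norm_real, Real.norm_eq_abs, abs_le]
    have h1 : max 0 (min 1 (2 - |x - μ| / c)) ≤ 1 := max_le zero_le_one (min_le_left _ _)
    have h2 := le_max_left 0 (min 1 (2 - |x - μ| / c))
    constructor <;> linarith

namespace TightBinding

/-! ### Matrix elements, restrictions and compressions -/

section entries

variable {d L : ℕ} {X Y : Set (Fin d → ℤ)}

theorem L2.ext {φ ψ : L2 X L} (h : ∀ n, φ.val n = ψ.val n) : φ = ψ :=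
  lp.ext (E := fun _ : X => EuclideanSpace ℂ (Fin L)) (p := 2) (funext h)

/-- Evaluation at a site, as a continuous linear map. -/
noncomputable def L2.valL (n : X) : L2 X L →L[ℂ] EuclideanSpace ℂ (Fin L) :=
  LinearMap.mkContinuous
    { toFun := fun φ => φ.val n
      map_add' := fun _ _ => rfl
      map_smul' := fun _ _ => rfl } 1 (fun φ => by
      rw [one_mul]
      exact lp.norm_apply_le_norm (E := fun _ : X => EuclideanSpace ℂ (Fin L)) (p := 2)
        (by norm_num) φ n)

/-- `v ↦ δ_n ⊗ v`, as a continuous linear map. -/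
noncomputable def L2.singleL (n : X) : EuclideanSpace ℂ (Fin L) →L[ℂ] L2 X L :=
  lp.singleContinuousLinearMap ℂ (fun _ : X => EuclideanSpace ℂ (Fin L)) 2 n

theorem L2.norm_single (n : X) (v : EuclideanSpace ℂ (Fin L)) : ‖L2.single n v‖ = ‖v‖ :=
  lp.norm_single (E := fun _ : X => EuclideanSpace ℂ (Fin L)) (p := 2) (by norm_num) n v

theorem L2.norm_val_le (φ : L2 X L) (n : X) : ‖φ.val n‖ ≤ ‖φ‖ :=
  lp.norm_apply_le_norm (E := fun _ : X => EuclideanSpace ℂ (Fin L)) (p := 2)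
        (by norm_num) φ n

theorem L2.single_val_self (n : X) (v : EuclideanSpace ℂ (Fin L)) : (L2.single n v).val n = v :=
  lp.single_apply_self (E := fun _ : X => EuclideanSpace ℂ (Fin L)) 2 n v

theorem L2.single_val_ne {n m : X} (h : m ≠ n) (v : EuclideanSpace ℂ (Fin L)) :
    (L2.single n v).val m = 0 :=
  lp.single_apply_ne (E := fun _ : X => EuclideanSpace ℂ (Fin L)) 2 n v h

theorem L2.hasSum_single (φ : L2 X L) : HasSum (fun n => L2.single n (φ.val n)) φ :=
  lp.hasSum_single (E := fun _ : X => EuclideanSpace ℂ (Fin L)) (p := 2) (by norm_num) φ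

theorem L2.inner_single (n : X) (v : EuclideanSpace ℂ (Fin L)) (φ : L2 X L) :
    inner ℂ (L2.single n v) φ = inner ℂ v (φ.val n) :=
  lp.inner_single_left (𝕜 := ℂ) (G := fun _ : X => EuclideanSpace ℂ (Fin L)) n v φ

theorem clm_ext_single {E : Type*} [NormedAddCommGroup E] [NormedSpace ℂ E]
    {S T : L2 X L →L[ℂ] E} (h : ∀ n v, S (L2.single n v) = T (L2.single n v)) : S = T := by
  ext φ
  have h1 := (L2.hasSum_single φ).mapL S
  simp only [h] at h1
  exact h1.unique ((L2.hasSum_single φ).mapL T)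

theorem op_ext {A B : Op X L} (h : ∀ n m v, entry A n m v = entry B n m v) : A = B :=
  clm_ext_single fun m v => L2.ext fun n => h n m v

theorem hasSum_entry_mul (A B : Op X L) (n m : X) (v : EuclideanSpace ℂ (Fin L)) :
    HasSum (fun k => entry A n k (entry B k m v)) (entry (A * B) n m v) :=
  (L2.hasSum_single (B (L2.single m v))).mapL ((L2.valL n).comp A)

theorem hasSum_val_apply (A : Op X L) (n : X) (φ : L2 X L) :
    HasSum (fun k => entry A n k (φ.val k)) ((A φ).val n) :=
  (L2.hasSum_single φ).mapL ((L2.valL n).comp A)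

theorem norm_entry_le (A : Op X L) (n m : X) (v : EuclideanSpace ℂ (Fin L)) :
    ‖entry A n m v‖ ≤ ‖A‖ * ‖v‖ :=
  (L2.norm_val_le _ n).trans ((A.le_opNorm _).trans (by rw [L2.norm_single]))

theorem entry_add (A B : Op X L) (n m : X) (v : EuclideanSpace ℂ (Fin L)) :
    entry (A + B) n m v = entry A n m v + entry B n m v := rfl

theorem entry_sub (A B : Op X L) (n m : X) (v : EuclideanSpace ℂ (Fin L)) :
    entry (A - B) n m v = entry A n m v - entry B n m v := rfl

theorem entry_smul (c : ℂ) (A : Op X L) (n m : X) (v : EuclideanSpace ℂ (Fin L)) :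
    entry (c • A) n m v = c • entry A n m v := rfl

theorem entry_one (n m : X) (v : EuclideanSpace ℂ (Fin L)) :
    entry (1 : Op X L) n m v = (L2.single m v).val n := rfl

theorem entry_apply_smul (A : Op X L) (n m : X) (c : ℂ) (v : EuclideanSpace ℂ (Fin L)) :
    entry A n m (c • v) = c • entry A n m v :=
  (((L2.valL n).comp A).comp (L2.singleL m)).map_smul c v

theorem entry_apply_zero (A : Op X L) (n m : X) :
    entry A n m (0 : EuclideanSpace ℂ (Fin L)) = 0 :=
  (((L2.valL n).comp A).comp (L2.singleL m)).map_zero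

theorem norm_restr_le (h : X ⊆ Y) : ‖restr L h‖ ≤ 1 :=
  LinearMap.mkContinuous_norm_le _ zero_le_one _

theorem restr_single (h : X ⊆ Y) (x : X) (v : EuclideanSpace ℂ (Fin L)) :
    restr L h (L2.single (Set.inclusion h x) v) = L2.single x v := by
  refine L2.ext fun n => ?_
  rw [restr_val]
  by_cases hn : n = x
  · rw [hn, L2.single_val_self, L2.single_val_self]
  · rw [L2.single_val_ne hn, L2.single_val_ne fun h' => hn (Set.inclusion_injective h h')]

theorem restr_single_of_notMem (h : X ⊆ Y) (y : Y) (hy : (y : Fin d → ℤ) ∉ X)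
    (v : EuclideanSpace ℂ (Fin L)) : restr L h (L2.single y v) = 0 := by
  refine L2.ext fun n => ?_
  rw [restr_val, L2.single_val_ne]
  · rfl
  · rintro rfl
    exact hy n.2

/-- The adjoint of restriction is extension by zero, as seen by pairing with an arbitrary vector. -/
theorem adjoint_restr_single (h : X ⊆ Y) (x : X) (v : EuclideanSpace ℂ (Fin L)) :
    ContinuousLinearMap.adjoint (restr L h) (L2.single x v) =
      L2.single (Set.inclusion h x) v := by
  refine ext_inner_right ℂ fun φ => ?_
  rw [ContinuousLinearMap.adjoint_inner_left, L2.inner_single, L2.inner_single, restr_val]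

theorem restr_adjoint_restr (h : X ⊆ Y) (φ : L2 X L) :
    restr L h (ContinuousLinearMap.adjoint (restr L h) φ) = φ := by
  have : (restr L h).comp (ContinuousLinearMap.adjoint (restr L h))
      = ContinuousLinearMap.id ℂ (L2 X L) := by
    refine clm_ext_single fun n v => ?_
    simp [adjoint_restr_single, restr_single]
  exact congrArg (fun T : L2 X L →L[ℂ] L2 X L => T φ) this

theorem adjoint_restr_restr_single (h : X ⊆ Y) (y : Y) (hy : (y : Fin d → ℤ) ∈ X)
    (v : EuclideanSpace ℂ (Fin L)) :
    ContinuousLinearMap.adjoint (restr L h) (restr L h (L2.single y v)) = L2.single y v := by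
  have := restr_single h ⟨y, hy⟩ v
  rw [show Set.inclusion h ⟨y, hy⟩ = y from rfl] at this
  rw [this, adjoint_restr_single]

/-- A vector vanishing off `X` is the extension by zero of its restriction to `X`. -/
theorem adjoint_restr_restr_of_val_eq_zero (h : X ⊆ Y) (φ : L2 Y L)
    (hφ : ∀ y : Y, (y : Fin d → ℤ) ∉ X → φ.val y = 0) :
    ContinuousLinearMap.adjoint (restr L h) (restr L h φ) = φ := by
  have h1 := (L2.hasSum_single φ).mapL ((ContinuousLinearMap.adjoint (restr L h)).comp (restr L h))
  refine h1.unique ?_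
  convert L2.hasSum_single φ using 2 with y
  by_cases hy : (y : Fin d → ℤ) ∈ X
  · exact adjoint_restr_restr_single h y hy _
  · rw [hφ y hy]
    exact (((ContinuousLinearMap.adjoint (restr L h)).comp (restr L h)).comp
      (L2.singleL y)).map_zero.trans (L2.singleL y).map_zero.symm

/-- The compression of an operator to a subset of sites. -/
noncomputable def compress (h : X ⊆ Y) (A : Op Y L) : Op X L :=
  restr L h ∘L A ∘L ContinuousLinearMap.adjoint (restr L h)

theorem entry_compress (h : X ⊆ Y) (A : Op Y L) (n m : X) (v : EuclideanSpace ℂ (Fin L)) :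
    entry (compress h A) n m v = entry A (Set.inclusion h n) (Set.inclusion h m) v := by
  simp only [entry, compress, ContinuousLinearMap.comp_apply, adjoint_restr_single, restr_val]

theorem norm_compress_le (h : X ⊆ Y) (A : Op Y L) : ‖compress h A‖ ≤ ‖A‖ := by
  have h1 : ‖ContinuousLinearMap.adjoint (restr L h)‖ ≤ 1 := by
    rw [LinearIsometryEquiv.norm_map]; exact norm_restr_le h
  refine (ContinuousLinearMap.opNorm_comp_le _ _).trans ?_
  refine (mul_le_of_le_one_left (norm_nonneg _) (norm_restr_le h)).trans ?_
  exact (ContinuousLinearMap.opNorm_comp_le _ _).trans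
    (mul_le_of_le_one_right (norm_nonneg _) h1)

theorem isSelfAdjoint_compress (h : X ⊆ Y) {A : Op Y L} (hA : IsSelfAdjoint A) :
    IsSelfAdjoint (compress h A) := by
  rw [ContinuousLinearMap.isSelfAdjoint_iff'] at hA ⊢
  simp only [compress, ContinuousLinearMap.adjoint_comp, ContinuousLinearMap.adjoint_adjoint, hA,
    ContinuousLinearMap.comp_assoc]

end entries

/-! ### Bounded families as a C⋆-algebra -/

/-- The bounded families of operators on `ℓ²(X, ℂ^L)`. -/
abbrev Family {d : ℕ} (X : Set (Fin d → ℤ)) (L : ℕ) (Ω : Type*) : Type _ :=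
  lp (fun _ : Ω => Op X L) ∞

/-- The C⋆-algebra structure on bounded families. -/
noncomputable abbrev Family.cstarAlgebra {d : ℕ} (X : Set (Fin d → ℤ)) (L : ℕ)
    [Nontrivial (L2 X L)] (Ω : Type*) : CStarAlgebra (Family X L Ω) where

attribute [local instance] Family.cstarAlgebra

instance nontrivial_univ (d L : ℕ) [NeZero L] :
    Nontrivial (L2 (Set.univ : Set (Fin d → ℤ)) L) := by
  refine ⟨L2.single ⟨0, trivial⟩ (EuclideanSpace.single (0 : Fin L) (1 : ℂ)), 0, fun h => ?_⟩
  have := congrArg norm h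
  rw [norm_zero, L2.norm_single] at this
  simp at this

/-- Evaluation of a family at `ω`. -/
noncomputable def Family.eval {d : ℕ} {X : Set (Fin d → ℤ)} {L : ℕ} [Nontrivial (L2 X L)]
    {Ω : Type*} (ω : Ω) : Family X L Ω →⋆ₐ[ℂ] Op X L where
  toFun A := A ω
  map_one' := rfl
  map_mul' _ _ := rfl
  map_zero' := rfl
  map_add' _ _ := rfl
  commutes' _ := rfl
  map_star' _ := rfl

theorem Family.eval_apply {d : ℕ} {X : Set (Fin d → ℤ)} {L : ℕ} [Nontrivial (L2 X L)]
    {Ω : Type*} (ω : Ω) (A : Family X L Ω) : Family.eval ω A = A ω := rfl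

theorem Family.continuous_eval {d : ℕ} {X : Set (Fin d → ℤ)} {L : ℕ} [Nontrivial (L2 X L)]
    {Ω : Type*} (ω : Ω) : Continuous (Family.eval (X := X) (L := L) ω) := by
  refine AddMonoidHomClass.continuous_of_bound (Family.eval (X := X) (L := L) ω) 1 fun A => ?_
  rw [one_mul]
  exact lp.norm_apply_le_norm ENNReal.top_ne_zero A ω

theorem Family.norm_le {d : ℕ} {X : Set (Fin d → ℤ)} {L : ℕ} {Ω : Type*} {A : Family X L Ω}
    {C : ℝ} (hC : 0 ≤ C) (h : ∀ ω, ‖A ω‖ ≤ C) : ‖A‖ ≤ C :=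
  lp.norm_le_of_forall_le hC h

theorem Family.norm_apply_le {d : ℕ} {X : Set (Fin d → ℤ)} {L : ℕ} {Ω : Type*} (A : Family X L Ω)
    (ω : Ω) : ‖A ω‖ ≤ ‖A‖ :=
  lp.norm_apply_le_norm ENNReal.top_ne_zero A ω

/-- A uniformly bounded family. -/
def Family.mk {d : ℕ} {X : Set (Fin d → ℤ)} {L : ℕ} {Ω : Type*} (A : Ω → Op X L) {C : ℝ}
    (h : ∀ ω, ‖A ω‖ ≤ C) : Family X L Ω :=
  ⟨A, memℓp_infty ⟨C, by rintro _ ⟨ω, rfl⟩; exact h ω⟩⟩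

/-! ### The algebra of covariant short range families -/

section local_families

variable {d L : ℕ} {X Y : Set (Fin d → ℤ)} {Ω : Type*}

theorem finite_norm_sub_le (m : X) (R : ℝ) : {k : X | ‖(k : Fin d → ℤ) - m‖ ≤ R}.Finite := by
  have h : (Metric.closedBall (m : Fin d → ℤ) R).Finite :=
    (isCompact_closedBall _ _).finite_of_discrete
  refine Set.Finite.subset (h.preimage Subtype.val_injective.injOn) fun k hk => ?_
  rw [Set.mem_preimage, Metric.mem_closedBall, dist_eq_norm]
  exact hk

/-- The phase is a character of the displacement. This makes covariance stable under products: the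
phases of `n - k` and `k - m` multiply to that of `n - m`. -/
theorem phase_add (B : Matrix (Fin d) (Fin d) ℝ) (a x y : Fin d → ℤ) :
    phase B a (x + y) = phase B a x * phase B a y := by
  have : (fun i => (((x + y) i : ℤ) : ℝ)) = (fun i => (x i : ℝ)) + fun i => (y i : ℝ) := by
    ext i; simp
  rw [phase, phase, phase, ← Complex.exp_add, this, Matrix.mulVec_add, dotProduct_add]
  congr 1
  push_cast
  ring

theorem phase_zero (B : Matrix (Fin d) (Fin d) ℝ) (a : Fin d → ℤ) : phase B a 0 = 1 := by
  have : (fun i => (((0 : Fin d → ℤ) i : ℤ) : ℝ)) = 0 := by ext i; simp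
  rw [phase, this, Matrix.mulVec_zero, dotProduct_zero]
  simp

theorem norm_phase (B : Matrix (Fin d) (Fin d) ℝ) (a x : Fin d → ℤ) : ‖phase B a x‖ = 1 := by
  rw [phase, show ∀ r : ℝ, Complex.I / 2 * (r : ℂ) = ((r / 2 : ℝ) : ℂ) * Complex.I from
    fun r => by push_cast; ring, Complex.norm_exp_ofReal_mul_I]

variable [TopologicalSpace Ω] [AddAction (Fin d → ℤ) Ω]

/-- Covariant, short range families with continuous matrix elements. -/
structure IsLocal (B : Matrix (Fin d) (Fin d) ℝ) (Γ : AddSubgroup (Fin d → ℤ))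
    (A : Ω → Op X L) : Prop where
  covariant : IsCovariant B Γ A
  shortRange : IsShortRange A
  continuousEntries : HasContinuousEntries A

variable {B : Matrix (Fin d) (Fin d) ℝ} {Γ : AddSubgroup (Fin d → ℤ)} {A A' : Ω → Op X L}

theorem IsLocal.add (h : IsLocal B Γ A) (h' : IsLocal B Γ A') :
    IsLocal B Γ (fun ω => A ω + A' ω) where
  covariant a ha ω n m n' m' hn hm v := by
    rw [entry_add, entry_add, h.covariant a ha ω n m n' m' hn hm v,
      h'.covariant a ha ω n m n' m' hn hm v, smul_add]
  shortRange := by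
    obtain ⟨R, hR⟩ := h.shortRange
    obtain ⟨R', hR'⟩ := h'.shortRange
    refine ⟨max R R', fun ω n m hnm v => ?_⟩
    rw [entry_add, hR ω n m ((le_max_left _ _).trans_lt hnm),
      hR' ω n m ((le_max_right _ _).trans_lt hnm), add_zero]
  continuousEntries n m v := (h.continuousEntries n m v).add (h'.continuousEntries n m v)

theorem IsLocal.smul (c : ℂ) (h : IsLocal B Γ A) : IsLocal B Γ (fun ω => c • A ω) where
  covariant a ha ω n m n' m' hn hm v := by
    rw [entry_smul, entry_smul, h.covariant a ha ω n m n' m' hn hm v, smul_comm]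
  shortRange := by
    obtain ⟨R, hR⟩ := h.shortRange
    exact ⟨R, fun ω n m hnm v => by rw [entry_smul, hR ω n m hnm, smul_zero]⟩
  continuousEntries n m v := (h.continuousEntries n m v).const_smul c

theorem IsLocal.sub (h : IsLocal B Γ A) (h' : IsLocal B Γ A') :
    IsLocal B Γ (fun ω => A ω - A' ω) := by
  simpa [sub_eq_add_neg] using h.add (h'.smul (-1))

-- The fibre is finite-dimensional, so continuity on each fixed vector gives continuity on a varying
-- one by expanding in a basis.
omit [AddAction (Fin d → ℤ) Ω] in
theorem HasContinuousEntries.comp (hA : HasContinuousEntries A) (n m : X)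
    {w : Ω → EuclideanSpace ℂ (Fin L)} (hw : Continuous w) :
    Continuous fun ω => entry (A ω) n m (w ω) := by
  have : ∀ ω, entry (A ω) n m (w ω)
      = ∑ i, w ω i • entry (A ω) n m (EuclideanSpace.basisFun (Fin L) ℂ i) := by
    intro ω
    conv_lhs => rw [← (EuclideanSpace.basisFun (Fin L) ℂ).sum_repr (w ω)]
    have := map_sum (((L2.valL n).comp (A ω)).comp (L2.singleL m))
      (fun i => (EuclideanSpace.basisFun (Fin L) ℂ).repr (w ω) i •
        EuclideanSpace.basisFun (Fin L) ℂ i) Finset.univ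
    refine this.trans (Finset.sum_congr rfl fun i _ => ?_)
    rw [map_smul]
    rfl
  simp only [this]
  refine continuous_finsetSum _ fun i _ => ?_
  exact Continuous.smul ((EuclideanSpace.proj (𝕜 := ℂ) i).continuous.comp hw) (hA n m _)

theorem IsLocal.mul (hX : ∀ a ∈ Γ, ∀ x ∈ X, a + x ∈ X) (h : IsLocal B Γ A)
    (h' : IsLocal B Γ A') : IsLocal B Γ (fun ω => A ω * A' ω) where
  covariant a ha ω n m n' m' hn hm v := by
    -- Translation by `a` permutes the sites of `X`; it reindexes the sum over intermediate sites.
    let e : X ≃ X :=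
      { toFun := fun k => ⟨a + k, hX a ha _ k.2⟩
        invFun := fun k => ⟨-a + k, hX (-a) (neg_mem ha) _ k.2⟩
        left_inv := fun k => by ext; simp
        right_inv := fun k => by ext; simp }
    have h1 := (e.hasSum_iff).2 (hasSum_entry_mul (A (a +ᵥ ω)) (A' (a +ᵥ ω)) n' m' v)
    refine h1.unique ?_
    convert (hasSum_entry_mul (A ω) (A' ω) n m v).const_smul (phase B a ((n : Fin d → ℤ) - m))
      using 2 with k
    rw [Function.comp_apply, h'.covariant a ha ω k m (e k) m' rfl hm v,
      h.covariant a ha ω n k n' (e k) hn rfl, entry_apply_smul, smul_smul, ← phase_add]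
    congr 2
    abel
  shortRange := by
    obtain ⟨R, hR⟩ := h.shortRange
    obtain ⟨R', hR'⟩ := h'.shortRange
    refine ⟨R + R', fun ω n m hnm v => (hasSum_entry_mul _ _ n m v).unique ?_⟩
    convert hasSum_zero using 2 with k
    by_cases hk : R' < ‖(k : Fin d → ℤ) - m‖
    · rw [hR' ω k m hk, entry_apply_zero]
    · refine hR ω n k ?_ _
      have := norm_sub_le_norm_sub_add_norm_sub (n : Fin d → ℤ) k m
      linarith
  continuousEntries n m v := by
    obtain ⟨R', hR'⟩ := h'.shortRange
    -- Finite range restricts the intermediate sites to a finite set independent of `ω`, so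
    -- continuity passes to the product.
    have : ∀ ω, entry (A ω * A' ω) n m v = ∑ k ∈ (finite_norm_sub_le m R').toFinset,
        entry (A ω) n k (entry (A' ω) k m v) := by
      intro ω
      refine (hasSum_entry_mul _ _ n m v).unique (hasSum_sum_of_ne_finset_zero fun k hk => ?_)
      rw [Set.Finite.mem_toFinset, Set.mem_ofPred_eq, not_le] at hk
      rw [hR' ω k m hk, entry_apply_zero]
    simp only [this]
    exact continuous_finsetSum _ fun k _ =>
      h.continuousEntries.comp n k (h'.continuousEntries k m v)

theorem IsLocal.one : IsLocal B Γ (fun _ : Ω => (1 : Op X L)) where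
  covariant a ha ω n m n' m' hn hm v := by
    rw [entry_one, entry_one]
    by_cases hnm : n = m
    · subst hnm
      have : n' = m' := Subtype.ext (hn.trans hm.symm)
      rw [this, sub_self, phase_zero, one_smul, L2.single_val_self, L2.single_val_self]
    · have : n' ≠ m' := fun h => hnm (Subtype.ext (by
        have := congrArg Subtype.val h
        rw [hn, hm] at this
        exact add_left_cancel this))
      rw [L2.single_val_ne this, L2.single_val_ne hnm, smul_zero]
  shortRange := ⟨0, fun ω n m hnm v => by
    rw [entry_one, L2.single_val_ne]
    rintro rfl
    simp at hnm⟩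
  continuousEntries n m v := continuous_const

theorem IsLocal.compress {A : Ω → Op Y L} (hXY : X ⊆ Y) {Γ' : AddSubgroup (Fin d → ℤ)}
    (hΓ : Γ' ≤ Γ) (h : IsLocal B Γ A) :
    IsLocal B Γ' (fun ω => TightBinding.compress hXY (A ω)) where
  covariant a ha ω n m n' m' hn hm v := by
    rw [entry_compress, entry_compress]
    exact h.covariant a (hΓ ha) ω (Set.inclusion hXY n) (Set.inclusion hXY m)
      (Set.inclusion hXY n') (Set.inclusion hXY m') hn hm v
  shortRange := by
    obtain ⟨R, hR⟩ := h.shortRange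
    exact ⟨R, fun ω n m hnm v => by rw [entry_compress]; exact hR ω (Set.inclusion hXY n) (Set.inclusion hXY m) hnm v⟩
  continuousEntries n m v := by
    simp only [entry_compress]
    exact h.continuousEntries (Set.inclusion hXY n) (Set.inclusion hXY m) v

/-- The algebra of bounded local families. -/
noncomputable def localSubalgebra [Nontrivial (L2 X L)] (Ω : Type*) [TopologicalSpace Ω]
    [AddAction (Fin d → ℤ) Ω]
    (B : Matrix (Fin d) (Fin d) ℝ) (Γ : AddSubgroup (Fin d → ℤ))
    (hX : ∀ a ∈ Γ, ∀ x ∈ X, a + x ∈ X) : Subalgebra ℂ (Family X L Ω) where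
  carrier := {A | IsLocal B Γ fun ω => A ω}
  mul_mem' h h' := h.mul hX h'
  add_mem' h h' := h.add h'
  algebraMap_mem' c := (IsLocal.one (Ω := Ω) (X := X) (L := L)).smul c

theorem IsLocal.aeval [Nontrivial (L2 X L)] (hX : ∀ a ∈ Γ, ∀ x ∈ X, a + x ∈ X)
    {A : Family X L Ω} (h : IsLocal B Γ fun ω => A ω) (q : Polynomial ℂ) :
    IsLocal B Γ fun ω => (Polynomial.aeval A q) ω := by
  have h1 : A ∈ localSubalgebra Ω B Γ hX := h
  have : Polynomial.aeval A q ∈ localSubalgebra Ω B Γ hX :=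
    Algebra.adjoin_singleton_le h1 (Polynomial.aeval_mem_adjoin_singleton ℂ A)
  exact this

end local_families

/-! ### Uniform boundedness of the Hamiltonian -/

theorem L2.hasSum_norm_sq {d L : ℕ} {X : Set (Fin d → ℤ)} (φ : L2 X L) :
    HasSum (fun n => ‖φ.val n‖ ^ 2) (‖φ‖ ^ 2) := by
  have := lp.hasSum_norm (E := fun _ : X => EuclideanSpace ℂ (Fin L)) (p := 2) (by norm_num) φ
  simp only [ENNReal.toReal_ofNat, Real.rpow_ofNat] at this
  exact this

/-- Schur test for operators with uniformly bounded matrix elements of finite range. -/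
theorem norm_le_of_entry_le {d L : ℕ} (A : Op (Set.univ : Set (Fin d → ℤ)) L)
    {C R : ℝ} (hC : 0 ≤ C) (hA : ∀ n m v, ‖entry A n m v‖ ≤ C * ‖v‖)
    (hR : ∀ n m : (Set.univ : Set (Fin d → ℤ)), R < ‖(n : Fin d → ℤ) - m‖ → ∀ v, entry A n m v = 0)
    (K : Finset (Fin d → ℤ)) (hK : ∀ k, ‖k‖ ≤ R → k ∈ K) :
    ‖A‖ ≤ C * K.card := by
  refine A.opNorm_le_bound (by positivity) fun φ => ?_
  let e : (Fin d → ℤ) → (Set.univ : Set (Fin d → ℤ)) ≃ (Set.univ : Set (Fin d → ℤ)) := fun k =>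
    { toFun := fun n => ⟨n + k, trivial⟩
      invFun := fun n => ⟨n - k, trivial⟩
      left_inv := fun n => by ext; simp
      right_inv := fun n => by ext; simp }
  have he : ∀ n, Function.Injective fun k => e k n := fun n k k' h => by
    simpa [e] using congrArg Subtype.val h
  -- Summing over displacements `k` instead of sites makes each term a shift of `φ`. Cauchy–Schwarz
  -- costs one factor `K.card`, and the sum over the shifts a second.
  have h1 : ∀ n, (A φ).val n = ∑ k ∈ K, entry A n (e k n) (φ.val (e k n)) := by
    intro n
    refine (hasSum_val_apply A n φ).unique ?_
    have : ∑ k ∈ K, entry A n (e k n) (φ.val (e k n))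
        = ∑ m ∈ K.map ⟨_, he n⟩, entry A n m (φ.val m) := by
      rw [Finset.sum_map]; rfl
    rw [this]
    refine hasSum_sum_of_ne_finset_zero fun m hm => hR n m ?_ _
    by_contra! hlt
    refine hm (Finset.mem_map.2 ⟨(m : Fin d → ℤ) - n, hK _ ?_, ?_⟩)
    · rwa [norm_sub_rev]
    · ext; simp [e]
  have h2 : ∀ n, ‖(A φ).val n‖ ^ 2 ≤ ∑ k ∈ K, (C ^ 2 * K.card) * ‖φ.val (e k n)‖ ^ 2 := by
    intro n
    have h3 : ‖(A φ).val n‖ ≤ ∑ k ∈ K, C * ‖φ.val (e k n)‖ := by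
      rw [h1]
      exact (norm_sum_le _ _).trans (Finset.sum_le_sum fun k _ => hA _ _ _)
    refine (pow_le_pow_left₀ (norm_nonneg _) h3 2).trans ?_
    refine sq_sum_le_card_mul_sum_sq.trans (le_of_eq ?_)
    rw [Finset.mul_sum]
    exact Finset.sum_congr rfl fun k _ => by ring
  have h4 : HasSum (fun n => ∑ k ∈ K, (C ^ 2 * K.card) * ‖φ.val (e k n)‖ ^ 2)
      (∑ k ∈ K, (C ^ 2 * K.card) * ‖φ‖ ^ 2) :=
    hasSum_sum fun k _ => ((e k).hasSum_iff.2 (L2.hasSum_norm_sq φ)).mul_left _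
  have h5 := hasSum_le h2 (L2.hasSum_norm_sq (A φ)) h4
  rw [Finset.sum_const, nsmul_eq_mul] at h5
  refine le_of_sq_le_sq ?_ (by positivity)
  calc _ ≤ _ := h5
    _ = _ := by ring

/-- A covariant short range family with continuous matrix elements is uniformly bounded. -/
theorem IsLocal.exists_norm_le {d L : ℕ} {Ω : Type*} [TopologicalSpace Ω] [CompactSpace Ω]
    [AddAction (Fin d → ℤ) Ω] {B : Matrix (Fin d) (Fin d) ℝ}
    {H : Ω → Op (Set.univ : Set (Fin d → ℤ)) L} (h : IsLocal B ⊤ H) :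
    ∃ C : ℝ, ∀ ω, ‖H ω‖ ≤ C := by
  obtain ⟨R, hR⟩ := h.shortRange
  have hfin : (Metric.closedBall (0 : Fin d → ℤ) R).Finite :=
    (isCompact_closedBall _ _).finite_of_discrete
  let K := hfin.toFinset
  let T : (Fin d → ℤ) → Ω → EuclideanSpace ℂ (Fin L) →L[ℂ] EuclideanSpace ℂ (Fin L) :=
    fun k ω => ((L2.valL (⟨k, trivial⟩ : (Set.univ : Set (Fin d → ℤ)))).comp (H ω)).comp
      (L2.singleL ⟨0, trivial⟩)
  -- Compactness of `Ω` bounds each matrix element on each vector, and Banach–Steinhaus turns this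
  -- into a norm bound.
  have hT : ∀ k, ∃ C, ∀ ω, ‖T k ω‖ ≤ C := fun k => banach_steinhaus fun v => by
    obtain ⟨C, hC⟩ := isCompact_univ.exists_bound_of_continuousOn
      (h.continuousEntries ⟨k, trivial⟩ ⟨0, trivial⟩ v).continuousOn
    exact ⟨C, fun ω => hC ω trivial⟩
  choose c hc using hT
  have hc0 : 0 ≤ ∑ k ∈ K, |c k| := Finset.sum_nonneg fun k _ => abs_nonneg _
  refine ⟨(∑ k ∈ K, |c k|) * K.card, fun ω => norm_le_of_entry_le (H ω) (R := R) hc0 ?_ (hR ω) K ?_⟩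
  · intro n m v
    by_cases hnm : R < ‖(n : Fin d → ℤ) - m‖
    · rw [hR ω n m hnm v, norm_zero]; positivity
    -- Translating by `-m` moves the entry `(n, m)` to `(n - m, 0)` at another point of `Ω`, up to a
    -- unimodular phase.
    · have h1 := h.covariant (-m) trivial ω n m ⟨-m + n, trivial⟩ ⟨0, trivial⟩ rfl (by simp) v
      have h2 : ‖entry (H ω) n m v‖ = ‖T (-m + n) (-(m : Fin d → ℤ) +ᵥ ω) v‖ := by
        have h3 := congrArg norm h1
        rw [norm_smul, norm_phase, one_mul] at h3
        exact h3.symm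
      rw [h2]
      refine (ContinuousLinearMap.le_opNorm _ _).trans ?_
      refine mul_le_mul_of_nonneg_right ?_ (norm_nonneg _)
      have hmem : -(m : Fin d → ℤ) + n ∈ K := by
        rw [Set.Finite.mem_toFinset, mem_closedBall_zero_iff, neg_add_eq_sub]
        exact not_lt.1 hnm
      exact (hc _ _).trans ((le_abs_self _).trans
        (Finset.single_le_sum (f := fun k => |c k|) (fun k _ => abs_nonneg _) hmem))
  · intro k hk
    rwa [Set.Finite.mem_toFinset, mem_closedBall_zero_iff]

/-! ### Strip-supported families and the edge algebra -/

section edge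

variable {p L : ℕ} {Ω : Type*}

/-- The matrix elements vanish unless both sites lie in the strip of width `N`. -/
def IsStripSupported (N : ℕ) (A : Ω → Op (halfSpace p) L) : Prop :=
  ∀ ω, ∀ n m : halfSpace p, ((n : Fin (p + 1) → ℤ) ∉ strip p N ∨
    (m : Fin (p + 1) → ℤ) ∉ strip p N) → ∀ v, entry (A ω) n m v = 0

/-- The compression of a bounded family to the half-space. -/
noncomputable def Family.toHalf (A : Family (Set.univ : Set (Fin (p + 1) → ℤ)) L Ω) :
    Family (halfSpace p) L Ω :=
  Family.mk (fun ω => halfRestriction (A ω)) (C := ‖A‖) fun ω =>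
    (norm_compress_le (Set.subset_univ _) (A ω)).trans (A.norm_apply_le ω)

theorem Family.toHalf_apply (A : Family (Set.univ : Set (Fin (p + 1) → ℤ)) L Ω) (ω : Ω) :
    A.toHalf ω = compress (Set.subset_univ _) (A ω) := rfl

theorem Family.norm_toHalf_le (A : Family (Set.univ : Set (Fin (p + 1) → ℤ)) L Ω) :
    ‖A.toHalf‖ ≤ ‖A‖ :=
  Family.norm_le (norm_nonneg _) fun ω =>
    (norm_compress_le (Set.subset_univ _) (A ω)).trans (A.norm_apply_le ω)

theorem tangential_add_mem_halfSpace (a : Fin (p + 1) → ℤ) (ha : a ∈ tangential p)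
    (x : Fin (p + 1) → ℤ) (hx : x ∈ halfSpace p) : a + x ∈ halfSpace p := by
  have h0 : a (Fin.last p) = 0 := ha
  change 1 ≤ a (Fin.last p) + x (Fin.last p)
  rw [h0, zero_add]
  exact hx

theorem halfSpace_notMem_strip {N : ℕ} {n : Fin (p + 1) → ℤ} (hn : n ∈ halfSpace p)
    (h : n ∉ strip p N) : (N : ℤ) < n (Fin.last p) := by
  by_contra! hlt
  exact h ⟨hn, hlt⟩

theorem last_sub_le_norm (n m : Fin (p + 1) → ℤ) :
    ((n (Fin.last p) - m (Fin.last p) : ℤ) : ℝ) ≤ ‖n - m‖ := by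
  have := norm_le_pi_norm (n - m) (Fin.last p)
  rw [Int.norm_eq_abs, Pi.sub_apply] at this
  exact (le_abs_self _).trans this

/-- Short range families vanishing deep inside the half-space are supported in a strip. -/
theorem exists_isStripSupported {A : Ω → Op (halfSpace p) L} (hA : IsShortRange A) (M : ℤ)
    (hM : ∀ ω, ∀ m : halfSpace p, M < (m : Fin (p + 1) → ℤ) (Fin.last p) →
      ∀ v, A ω (L2.single m v) = 0) : ∃ N, IsStripSupported N A := by
  obtain ⟨R, hR⟩ := hA
  -- Columns beyond depth `M` vanish, and columns up to depth `M` reach no deeper than `M + R`.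
  refine ⟨(max M ⌈M + R⌉).toNat, fun ω n m hnm v => ?_⟩
  have hN := Int.self_le_toNat (max M ⌈M + R⌉)
  by_cases hm : M < (m : Fin (p + 1) → ℤ) (Fin.last p)
  · rw [entry, hM ω m hm v]; rfl
  · refine hR ω n m ?_ v
    rcases hnm with hnm | hnm
    · have h1 := halfSpace_notMem_strip n.2 hnm
      have h2 : ⌈(M : ℝ) + R⌉ < (n : Fin (p + 1) → ℤ) (Fin.last p) :=
        ((le_max_right _ _).trans hN).trans_lt h1
      have h3 := last_sub_le_norm (n : Fin (p + 1) → ℤ) m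
      have h4 := Int.ceil_lt_add_one ((M : ℝ) + R)
      have h5 : ((m : Fin (p + 1) → ℤ) (Fin.last p) : ℝ) ≤ M := by exact_mod_cast not_lt.1 hm
      have h6 : (M : ℝ) + R < ((n : Fin (p + 1) → ℤ) (Fin.last p) : ℝ) :=
        (Int.le_ceil _).trans_lt (by exact_mod_cast h2)
      push_cast at h3
      linarith
    · exact absurd (((le_max_left _ _).trans hN).trans_lt (halfSpace_notMem_strip m.2 hnm)) hm

variable [TopologicalSpace Ω] [AddAction (Fin (p + 1) → ℤ) Ω]
  {B : Matrix (Fin (p + 1)) (Fin (p + 1)) ℝ}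

theorem mem_edgeAlgebra [NeZero L] {A : HalfFamily p L Ω}
    (hA : IsLocal B (tangential p) fun ω => A ω) {N : ℕ} (hN : IsStripSupported N fun ω => A ω) :
    A ∈ edgeAlgebra p L Ω B :=
  NonUnitalStarSubalgebra.le_topologicalClosure _
    (NonUnitalStarAlgebra.subset_adjoin ℂ _ ⟨hA.1, hA.2, hA.3, N, hN⟩)

theorem isClosed_edgeAlgebra [NeZero L] : IsClosed (edgeAlgebra p L Ω B : Set (HalfFamily p L Ω)) :=
  NonUnitalStarSubalgebra.isClosed_topologicalClosure _

theorem edgeAlgebra_le_edgeUnitization [NeZero L] {x : HalfFamily p L Ω}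
    (hx : x ∈ edgeAlgebra p L Ω B) : x ∈ edgeUnitization p L Ω B :=
  StarAlgebra.subset_adjoin ℂ _ hx

theorem isClosed_edgeUnitization [NeZero L] :
    IsClosed (edgeUnitization p L Ω B : Set (HalfFamily p L Ω)) :=
  NonUnitalStarSubalgebra.isClosed_adjoin isClosed_edgeAlgebra

end edge

/-! ### Comparison of polynomials in the bulk and half-space Hamiltonians -/

section toeplitz

variable {p L : ℕ} [NeZero L] {Ω : Type*}

-- A site deeper than the range is too far from the complement of the half-space to be coupled to
-- it.
omit [NeZero L] in
theorem exists_val_eq_zero_of_isShortRange {A : Ω → Op (Set.univ : Set (Fin (p + 1) → ℤ)) L}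
    (hA : IsShortRange A) : ∃ M : ℤ, ∀ ω, ∀ m : halfSpace p,
      M < (m : Fin (p + 1) → ℤ) (Fin.last p) → ∀ v,
      ∀ y : (Set.univ : Set (Fin (p + 1) → ℤ)), (y : Fin (p + 1) → ℤ) ∉ halfSpace p →
        (A ω (L2.single (Set.inclusion (Set.subset_univ _) m) v)).val y = 0 := by
  obtain ⟨R, hR⟩ := hA
  refine ⟨⌈R⌉, fun ω m hm v y hy => hR ω y _ ?_ v⟩
  have h1 := last_sub_le_norm (m : Fin (p + 1) → ℤ) y
  have h2 : (y : Fin (p + 1) → ℤ) (Fin.last p) ≤ 0 := by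
    by_contra! h
    exact hy h
  have h3 : (⌈R⌉ : ℝ) < ((m : Fin (p + 1) → ℤ) (Fin.last p) : ℝ) := by exact_mod_cast hm
  have h4 : ((y : Fin (p + 1) → ℤ) (Fin.last p) : ℝ) ≤ 0 := by exact_mod_cast h2
  rw [norm_sub_rev] at h1
  push_cast at h1
  have h5 := Int.le_ceil R
  exact lt_of_lt_of_le (by linarith) h1

/-- Polynomials in the half-space Hamiltonian agree deep inside the half-space with the
compressions of the same polynomials in the bulk Hamiltonian. -/
theorem exists_aeval_toHalf_sub_single [TopologicalSpace Ω] [AddAction (Fin (p + 1) → ℤ) Ω]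
    {B : Matrix (Fin (p + 1)) (Fin (p + 1)) ℝ}
    {H : Family (Set.univ : Set (Fin (p + 1) → ℤ)) L Ω} (hH : IsLocal B ⊤ fun ω => H ω)
    (q : Polynomial ℂ) :
    ∃ M : ℤ, ∀ ω, ∀ m : halfSpace p, M < (m : Fin (p + 1) → ℤ) (Fin.last p) → ∀ v,
      (Polynomial.aeval H.toHalf q - (Polynomial.aeval H q).toHalf) ω (L2.single m v) = 0 := by
  induction q using Polynomial.induction_on' with
  | add q₁ q₂ h₁ h₂ =>
    obtain ⟨M₁, h₁⟩ := h₁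
    obtain ⟨M₂, h₂⟩ := h₂
    refine ⟨max M₁ M₂, fun ω m hm v => ?_⟩
    have e : (Polynomial.aeval H.toHalf (q₁ + q₂) - (Polynomial.aeval H (q₁ + q₂)).toHalf) ω
        = (Polynomial.aeval H.toHalf q₁ - (Polynomial.aeval H q₁).toHalf) ω
        + (Polynomial.aeval H.toHalf q₂ - (Polynomial.aeval H q₂).toHalf) ω := by
      rw [map_add, map_add]
      ext φ
      simp [Family.toHalf_apply, compress]
      abel
    rw [e, add_apply, h₁ ω m ((le_max_left _ _).trans_lt hm),
      h₂ ω m ((le_max_right _ _).trans_lt hm), add_zero]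
  | monomial k c =>
    suffices h : ∃ M : ℤ, ∀ ω, ∀ m : halfSpace p, M < (m : Fin (p + 1) → ℤ) (Fin.last p) → ∀ v,
        ((H.toHalf ω) ^ k) (L2.single m v) =
          (compress (Set.subset_univ (halfSpace p)) ((H ω) ^ k)) (L2.single m v) by
      obtain ⟨M, hM⟩ := h
      refine ⟨M, fun ω m hm v => ?_⟩
      have e : (Polynomial.aeval H.toHalf (Polynomial.monomial k c) -
          (Polynomial.aeval H (Polynomial.monomial k c)).toHalf) ω
          = c • ((H.toHalf ω) ^ k - compress (Set.subset_univ (halfSpace p)) ((H ω) ^ k)) := by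
        rw [Polynomial.aeval_monomial, Polynomial.aeval_monomial, ← Algebra.smul_def,
          ← Algebra.smul_def, smul_sub]
        refine congrArg (fun T => c • (H.toHalf ω) ^ k - T) ?_
        ext φ
        simp [Family.toHalf_apply, compress]
      rw [e, smul_apply, sub_apply, hM ω m hm, sub_self,
        smul_zero]
    induction k with
    | zero =>
      refine ⟨0, fun ω m _ v => ?_⟩
      simp [compress, restr_adjoint_restr]
    | succ k ih =>
      obtain ⟨M, hM⟩ := ih
      have h1 : IsShortRange fun ω => (H ω) ^ k := by
        have := (hH.aeval (fun _ _ _ _ => Set.mem_univ _) (Polynomial.X ^ k)).shortRange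
        rw [Polynomial.aeval_X_pow] at this
        exact this
      obtain ⟨M', hM'⟩ := exists_val_eq_zero_of_isShortRange h1
      refine ⟨max M M', fun ω m hm v => ?_⟩
      -- Deep inside, the vector `H ^ k δ_m` already lives on the half-space, so the truncation
      -- between `H` and `H ^ k` does nothing.
      rw [pow_succ', mul_apply_eq_comp, hM ω m ((le_max_left _ _).trans_lt hm),
        pow_succ', Family.toHalf_apply]
      simp only [compress, ContinuousLinearMap.comp_apply, mul_apply_eq_comp]
      rw [adjoint_restr_single, adjoint_restr_restr_of_val_eq_zero]
      exact hM' ω m ((le_max_right _ _).trans_lt hm) v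

end toeplitz

/-! ### The projection onto a strip -/

section strip

variable {p L : ℕ} {Ω : Type*}

theorem norm_adjoint_comp_stripProj_le (N : ℕ) :
    ‖ContinuousLinearMap.adjoint (stripProj p L N) ∘L stripProj p L N‖ ≤ 1 := by
  have h1 : ‖ContinuousLinearMap.adjoint (stripProj p L N)‖ ≤ 1 := by
    rw [LinearIsometryEquiv.norm_map]; exact norm_restr_le _
  exact (ContinuousLinearMap.opNorm_comp_le _ _).trans
    (mul_le_one₀ h1 (norm_nonneg _) (norm_restr_le _))

/-- The projection onto the strip of width `N`, as a constant family. -/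
noncomputable def stripFamily (p L : ℕ) (Ω : Type*) (N : ℕ) : HalfFamily p L Ω :=
  Family.mk (fun _ => ContinuousLinearMap.adjoint (stripProj p L N) ∘L stripProj p L N)
    fun _ => norm_adjoint_comp_stripProj_le N

theorem stripFamily_apply (N : ℕ) (ω : Ω) : stripFamily p L Ω N ω =
    ContinuousLinearMap.adjoint (stripProj p L N) ∘L stripProj p L N := rfl

theorem norm_stripFamily_le (N : ℕ) : ‖stripFamily p L Ω N‖ ≤ 1 :=
  Family.norm_le zero_le_one fun _ => norm_adjoint_comp_stripProj_le N

theorem stripProj_adjoint_apply (N : ℕ) (φ : L2 (strip p N) L) :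
    stripProj p L N (ContinuousLinearMap.adjoint (stripProj p L N) φ) = φ :=
  restr_adjoint_restr (strip_subset p N) φ

theorem stripFamily_mul_self [NeZero L] (N : ℕ) :
    stripFamily p L Ω N * stripFamily p L Ω N = stripFamily p L Ω N := by
  ext ω φ : 3
  change ContinuousLinearMap.adjoint (stripProj p L N) (stripProj p L N
    (ContinuousLinearMap.adjoint (stripProj p L N) (stripProj p L N φ))) = _
  rw [stripProj_adjoint_apply]
  rfl

theorem stripFamily_single_of_mem (N : ℕ) (ω : Ω) {m : halfSpace p}
    (hm : (m : Fin (p + 1) → ℤ) ∈ strip p N) (v : EuclideanSpace ℂ (Fin L)) :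
    stripFamily p L Ω N ω (L2.single m v) = L2.single m v :=
  adjoint_restr_restr_single (strip_subset p N) m hm v

theorem stripFamily_single_of_notMem (N : ℕ) (ω : Ω) {m : halfSpace p}
    (hm : (m : Fin (p + 1) → ℤ) ∉ strip p N) (v : EuclideanSpace ℂ (Fin L)) :
    stripFamily p L Ω N ω (L2.single m v) = 0 := by
  rw [stripFamily_apply, ContinuousLinearMap.comp_apply, stripProj,
    restr_single_of_notMem _ m hm, map_zero]

theorem isStripSupported_stripFamily (N : ℕ) :
    IsStripSupported N fun ω => stripFamily p L Ω N ω := by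
  intro ω n m hnm v
  by_cases hm : (m : Fin (p + 1) → ℤ) ∈ strip p N
  · have hn : (n : Fin (p + 1) → ℤ) ∉ strip p N := hnm.resolve_right (not_not.2 hm)
    rw [entry, stripFamily_single_of_mem N ω hm, L2.single_val_ne]
    rintro rfl
    exact hn hm
  · rw [entry, stripFamily_single_of_notMem N ω hm]
    rfl

theorem tangential_add_mem_strip {N : ℕ} {a x : Fin (p + 1) → ℤ} (ha : a ∈ tangential p) :
    a + x ∈ strip p N ↔ x ∈ strip p N := by
  have h0 : a (Fin.last p) = 0 := ha
  change (1 ≤ a (Fin.last p) + x (Fin.last p) ∧ a (Fin.last p) + x (Fin.last p) ≤ N) ↔ _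
  rw [h0, zero_add]
  rfl

theorem IsStripSupported.mul_stripFamily [NeZero L] {D : HalfFamily p L Ω} {N N' : ℕ}
    (hD : IsStripSupported N' fun ω => D ω) (h : N' ≤ N) : D * stripFamily p L Ω N = D := by
  ext ω : 2
  refine clm_ext_single fun m v => ?_
  change D ω (stripFamily p L Ω N ω (L2.single m v)) = _
  by_cases hm : (m : Fin (p + 1) → ℤ) ∈ strip p N
  · rw [stripFamily_single_of_mem N ω hm]
  · rw [stripFamily_single_of_notMem N ω hm, map_zero]
    refine L2.ext fun n => ((hD ω n m (Or.inr fun h' => hm ⟨h'.1, h'.2.trans ?_⟩) v).symm)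
    exact_mod_cast h

theorem IsStripSupported.stripFamily_mul [NeZero L] {D : HalfFamily p L Ω} {N N' : ℕ}
    (hD : IsStripSupported N' fun ω => D ω) (h : N' ≤ N) : stripFamily p L Ω N * D = D := by
  ext ω : 2
  refine clm_ext_single fun m v => ?_
  refine adjoint_restr_restr_of_val_eq_zero (strip_subset p N) _ fun n hn => ?_
  refine hD ω n m (Or.inl fun h' => hn ⟨h'.1, h'.2.trans ?_⟩) v
  exact_mod_cast h

variable [TopologicalSpace Ω] [AddAction (Fin (p + 1) → ℤ) Ω]
  {B : Matrix (Fin (p + 1)) (Fin (p + 1)) ℝ}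

theorem isLocal_stripFamily (N : ℕ) :
    IsLocal B (tangential p) fun ω => stripFamily p L Ω N ω where
  covariant a ha ω n m n' m' hn hm v := by
    by_cases h : (m : Fin (p + 1) → ℤ) ∈ strip p N
    · have h' : (m' : Fin (p + 1) → ℤ) ∈ strip p N := by
        rw [hm]; exact (tangential_add_mem_strip ha).2 h
      rw [entry, entry, stripFamily_single_of_mem N _ h, stripFamily_single_of_mem N _ h']
      exact (IsLocal.one (Ω := Ω)).covariant a ha ω n m n' m' hn hm v
    · have h' : (m' : Fin (p + 1) → ℤ) ∉ strip p N := by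
        rw [hm]; exact fun h'' => h ((tangential_add_mem_strip ha).1 h'')
      rw [entry, entry, stripFamily_single_of_notMem N _ h, stripFamily_single_of_notMem N _ h']
      exact (smul_zero _).symm
  shortRange := by
    refine ⟨0, fun ω n m hnm v => ?_⟩
    by_cases h : (m : Fin (p + 1) → ℤ) ∈ strip p N
    · rw [entry, stripFamily_single_of_mem N _ h, L2.single_val_ne]
      rintro rfl
      simp at hnm
    · rw [entry, stripFamily_single_of_notMem N _ h]
      rfl
  continuousEntries n m v := by
    simp only [stripFamily_apply]
    exact continuous_const

/-- This keeps the path from 1 to `1 - 2P` inside the unitization. -/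
theorem stripFamily_mem_edgeAlgebra [NeZero L] (N : ℕ) :
    stripFamily p L Ω N ∈ edgeAlgebra p L Ω B :=
  mem_edgeAlgebra (isLocal_stripFamily N) (isStripSupported_stripFamily N)

end strip

/-! ### Functions supported in the bulk gap -/

section gap

variable {p L : ℕ} [NeZero L] {Ω : Type*} [TopologicalSpace Ω] [AddAction (Fin (p + 1) → ℤ) Ω]
  {B : Matrix (Fin (p + 1)) (Fin (p + 1)) ℝ}
  {H : Family (Set.univ : Set (Fin (p + 1) → ℤ)) L Ω}

theorem rcfc_eq_zero_of_disjoint {A : Type*} [CStarAlgebra A] {x : A} (hx : IsSelfAdjoint x)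
    {s : Set ℝ} (hs : Disjoint (spectrum ℝ x) s) {F : ℝ → ℂ} (hF : ∀ t ∉ s, F t = 0) :
    rcfc F x = 0 := by
  have : rcfc F x = cfc (fun _ : ℂ => (0 : ℂ)) x := by
    refine cfc_congr fun z hz => hF _ (Set.disjoint_left.1 hs ?_)
    rw [← spectrum.algebraMap_mem_iff ℂ]
    change ((z.re : ℝ) : ℂ) ∈ _
    rwa [hx.re_of_mem_spectrum hz]
  rw [this, cfc_const_zero]

omit [NeZero L] [TopologicalSpace Ω] in
theorem isSelfAdjoint_apply {d : ℕ} {X : Set (Fin d → ℤ)} [Nontrivial (L2 X L)] {A : Family X L Ω}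
    (hA : IsSelfAdjoint A) (ω : Ω) : IsSelfAdjoint (A ω) := by
  rw [← Family.eval_apply]
  exact hA.map (Family.eval ω)

omit [NeZero L] [TopologicalSpace Ω] in
theorem eval_rcfc {d : ℕ} {X : Set (Fin d → ℤ)} [Nontrivial (L2 X L)] 
    {A : Family X L Ω} (hA : IsSelfAdjoint A) {F : ℝ → ℂ} (hF : Continuous F) (ω : Ω) :
    rcfc F A ω = rcfc F (A ω) := by
  have h := map_rcfc (A := Family X L Ω) (B := Op X L) (F := F) (a := A) (Family.eval ω)
    (Family.continuous_eval ω) hA hF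
  exact h

/-- If almost all bulk Hamiltonians have a gap, then functions supported in the gap vanish on all
of them. -/
theorem rcfc_eq_zero_of_ae_gap [MeasurableSpace Ω] {P : Measure Ω} [P.IsOpenPosMeasure]
    (hH : IsLocal B ⊤ fun ω => H ω) (hself : IsSelfAdjoint H) {s : Set ℝ}
    (hgap : ∀ᵐ ω ∂P, Disjoint (spectrum ℝ (H ω)) s) {F : ℝ → ℂ} (hF : Continuous F)
    (hFs : ∀ t ∉ s, F t = 0) : rcfc F H = 0 := by
  -- Full support: a conull set is dense, so continuous matrix elements vanishing on it vanish
  -- everywhere.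
  have hdense := Measure.dense_of_ae hgap
  ext ω₀ : 2
  refine op_ext fun n m v => ?_
  -- The entries of `F(H)` are uniform limits of those of polynomials in `H`, which are continuous
  -- by locality.
  have hcont : Continuous fun ω => entry (rcfc F H ω) n m v := by
    refine continuous_of_uniform_approx_of_continuous fun u hu => ?_
    obtain ⟨ε, hε, hu⟩ := Metric.mem_uniformity_dist.1 hu
    obtain ⟨q, hq⟩ := exists_polynomial_near_rcfc hF ‖H‖ (ε := ε / (2 * (‖v‖ + 1)))
      (by positivity)
    refine ⟨fun ω => entry (Polynomial.aeval H q ω) n m v,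
      (hH.aeval (fun _ _ _ _ => Set.mem_univ _) q).continuousEntries n m v, fun ω => hu ?_⟩
    rw [dist_eq_norm, ← entry_sub]
    have h1 := norm_entry_le (rcfc F H ω - Polynomial.aeval H q ω) n m v
    have h2 := (Family.norm_apply_le (rcfc F H - Polynomial.aeval H q) ω).trans
      (hq _ H hself le_rfl)
    refine h1.trans_lt ((mul_le_mul_of_nonneg_right h2 (norm_nonneg _)).trans_lt ?_)
    rw [div_mul_eq_mul_div, div_lt_iff₀ (by positivity)]
    nlinarith [norm_nonneg v]
  have := hcont.ext_on hdense (continuous_const (y := (0 : EuclideanSpace ℂ (Fin L))))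
    fun ω hω => by
      change entry (rcfc F H ω) n m v = 0
      rw [eval_rcfc hself hF, rcfc_eq_zero_of_disjoint (isSelfAdjoint_apply hself ω) hω hFs]
      rfl
  exact congrFun this ω₀

omit [TopologicalSpace Ω] [AddAction (Fin (p + 1) → ℤ) Ω] in
theorem isSelfAdjoint_toHalf (hself : IsSelfAdjoint H) : IsSelfAdjoint H.toHalf := by
  ext ω : 2
  exact isSelfAdjoint_compress (Set.subset_univ _) (isSelfAdjoint_apply hself ω)

/-- Functions of the half-space Hamiltonian which vanish on the bulk Hamiltonian are approximated
by local families supported in a strip. -/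
theorem exists_isLocal_near (hH : IsLocal B ⊤ fun ω => H ω) (hself : IsSelfAdjoint H)
    {F : ℝ → ℂ} (hF : Continuous F) (h0 : rcfc F H = 0) {ε : ℝ} (hε : 0 < ε) :
    ∃ D : HalfFamily p L Ω, ∃ N, IsLocal B (tangential p) (fun ω => D ω) ∧
      IsStripSupported N (fun ω => D ω) ∧ ‖rcfc F H.toHalf - D‖ ≤ ε := by
  -- The same `q` serves bulk and half-space. As `F(H) = 0`, the operator `q(H)` is small, so
  -- subtracting its compression from `q(Ĥ)` costs only `ε/2` and leaves a strip-supported family.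
  obtain ⟨q, hq⟩ := exists_polynomial_near_rcfc hF ‖H‖ (half_pos hε)
  have h1 := hq _ H hself le_rfl
  have h2 := hq _ H.toHalf (isSelfAdjoint_toHalf hself) H.norm_toHalf_le
  rw [h0, zero_sub, norm_neg] at h1
  have hloc : IsLocal B (tangential p) fun ω =>
      (Polynomial.aeval H.toHalf q - (Polynomial.aeval H q).toHalf) ω :=
    ((hH.compress (Set.subset_univ (halfSpace p)) le_top).aeval (A := H.toHalf)
        tangential_add_mem_halfSpace q).sub
      ((hH.aeval (fun _ _ _ _ => Set.mem_univ _) q).compress (Set.subset_univ (halfSpace p)) le_top)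
  obtain ⟨M, hM⟩ := exists_aeval_toHalf_sub_single hH q
  obtain ⟨N, hN⟩ := exists_isStripSupported hloc.shortRange M hM
  refine ⟨_, N, hloc, hN, ?_⟩
  rw [← sub_add]
  exact (norm_add_le _ _).trans
    ((add_le_add h2 ((Family.norm_toHalf_le _).trans h1)).trans (by linarith))

/-- The edge algebra is norm closed and the approximants of `exists_isLocal_near` are among its
generators. -/
theorem rcfc_mem_edgeAlgebra (hH : IsLocal B ⊤ fun ω => H ω) (hself : IsSelfAdjoint H)
    {F : ℝ → ℂ} (hF : Continuous F) (h0 : rcfc F H = 0) :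
    rcfc F H.toHalf ∈ edgeAlgebra p L Ω B := by
  refine isClosed_edgeAlgebra.closure_subset (Metric.mem_closure_iff.2 fun ε hε => ?_)
  obtain ⟨D, N, h1, h2, h3⟩ := exists_isLocal_near hH hself hF h0 (half_pos hε)
  exact ⟨D, mem_edgeAlgebra h1 h2, by rw [dist_eq_norm]; linarith⟩

/-- Compressions of functions of the half-space Hamiltonian to a strip are in the edge algebra. -/
theorem stripFamily_mul_rcfc_mul_mem (hH : IsLocal B ⊤ fun ω => H ω) (hself : IsSelfAdjoint H)
    {F : ℝ → ℂ} (hF : Continuous F) (N : ℕ) :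
    stripFamily p L Ω N * rcfc F H.toHalf * stripFamily p L Ω N ∈ edgeAlgebra p L Ω B := by
  refine isClosed_edgeAlgebra.closure_subset (Metric.mem_closure_iff.2 fun ε hε => ?_)
  obtain ⟨q, hq⟩ := exists_polynomial_near_rcfc hF ‖H‖ (half_pos hε)
  have h2 := hq _ H.toHalf (isSelfAdjoint_toHalf hself) H.norm_toHalf_le
  set P := stripFamily p L Ω N with hP
  -- Cutting on both sides confines any polynomial in `Ĥ` to the strip, whether or not the function
  -- vanishes on the bulk.
  refine ⟨P * Polynomial.aeval H.toHalf q * P, ?_, ?_⟩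
  · refine mem_edgeAlgebra (N := N) ?_ ?_
    · exact ((isLocal_stripFamily N).mul tangential_add_mem_halfSpace
        ((hH.compress (Set.subset_univ (halfSpace p)) le_top).aeval (A := H.toHalf)
        tangential_add_mem_halfSpace q)).mul tangential_add_mem_halfSpace (isLocal_stripFamily N)
    · intro ω n m hnm v
      by_cases hm : (m : Fin (p + 1) → ℤ) ∈ strip p N
      · have hn : (n : Fin (p + 1) → ℤ) ∉ strip p N := hnm.resolve_right (not_not.2 hm)
        have := (hasSum_entry_mul (P ω) ((Polynomial.aeval H.toHalf q * P) ω) n m v)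
        rw [mul_assoc]
        refine this.unique ?_
        convert hasSum_zero using 2 with k
        exact isStripSupported_stripFamily N ω n k (Or.inl hn) _
      · change ((P * Polynomial.aeval H.toHalf q) ω (P ω (L2.single m v))).val n = 0
        rw [hP, stripFamily_single_of_notMem N ω hm, map_zero]
        rfl
  · rw [dist_eq_norm, ← sub_mul, ← mul_sub]
    have hPn : ‖P‖ ≤ 1 := norm_stripFamily_le N
    calc _ ≤ ‖P * (rcfc F H.toHalf - Polynomial.aeval H.toHalf q)‖ * ‖P‖ := norm_mul_le _ _
      _ ≤ ‖P * (rcfc F H.toHalf - Polynomial.aeval H.toHalf q)‖ :=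
        mul_le_of_le_one_right (norm_nonneg _) hPn
      _ ≤ ‖P‖ * ‖rcfc F H.toHalf - Polynomial.aeval H.toHalf q‖ := norm_mul_le _ _
      _ ≤ ‖rcfc F H.toHalf - Polynomial.aeval H.toHalf q‖ :=
        mul_le_of_le_one_left (norm_nonneg _) hPn
      _ < ε := by linarith

/-- Functions of the half-space Hamiltonian which vanish on the bulk Hamiltonian decay into the
half-space. -/
theorem exists_norm_rcfc_mul_compl_le (hH : IsLocal B ⊤ fun ω => H ω) (hself : IsSelfAdjoint H)
    {F : ℝ → ℂ} (hF : Continuous F) (h0 : rcfc F H = 0) {ε : ℝ} (hε : 0 < ε) :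
    ∃ N₀ : ℕ, ∀ N, N₀ ≤ N → ‖rcfc F H.toHalf * (1 - stripFamily p L Ω N)‖ ≤ ε ∧
      ‖(1 - stripFamily p L Ω N) * rcfc F H.toHalf‖ ≤ ε := by
  obtain ⟨D, N₀, h1, h2, h3⟩ := exists_isLocal_near hH hself hF h0 (half_pos hε)
  refine ⟨N₀, fun N hN => ?_⟩
  -- The triangle inequality suffices here, since the approximation was made to within `ε/2`.
  have hQ : ‖1 - stripFamily p L Ω N‖ ≤ 2 := by
    refine (norm_sub_le _ _).trans ?_
    have : ‖(1 : HalfFamily p L Ω)‖ ≤ 1 := Family.norm_le zero_le_one fun ω =>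
      ContinuousLinearMap.norm_id_le
    linarith [norm_stripFamily_le (p := p) (L := L) (Ω := Ω) N]
  have e1 : rcfc F H.toHalf * (1 - stripFamily p L Ω N)
      = (rcfc F H.toHalf - D) * (1 - stripFamily p L Ω N) := by
    rw [sub_mul, mul_sub D, h2.mul_stripFamily hN, mul_one, sub_self, sub_zero]
  have e2 : (1 - stripFamily p L Ω N) * rcfc F H.toHalf
      = (1 - stripFamily p L Ω N) * (rcfc F H.toHalf - D) := by
    rw [mul_sub, sub_mul _ _ D, h2.stripFamily_mul hN, one_mul, sub_self, sub_zero]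
  rw [e1, e2]
  constructor
  · refine (norm_mul_le _ _).trans ?_
    nlinarith [norm_nonneg (rcfc F H.toHalf - D), norm_nonneg (1 - stripFamily p L Ω N)]
  · refine (norm_mul_le _ _).trans ?_
    nlinarith [norm_nonneg (rcfc F H.toHalf - D), norm_nonneg (1 - stripFamily p L Ω N)]

end gap

/-! ### The Cayley transform of the Green function on the strip -/

section extendByOne

variable {p L N : ℕ}

theorem extendByOne_apply (X : Op (strip p N) L) (φ : L2 (halfSpace p) L) :
    extendByOne X φ = ContinuousLinearMap.adjoint (stripProj p L N) (X (stripProj p L N φ)) +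
      (φ - ContinuousLinearMap.adjoint (stripProj p L N) (stripProj p L N φ)) := rfl

theorem stripProj_extendByOne (X : Op (strip p N) L) (φ : L2 (halfSpace p) L) :
    stripProj p L N (extendByOne X φ) = X (stripProj p L N φ) := by
  rw [extendByOne_apply, map_add, map_sub, stripProj_adjoint_apply, stripProj_adjoint_apply,
    sub_self, add_zero]

theorem extendByOne_mul (X Y : Op (strip p N) L) :
    extendByOne X * extendByOne Y = extendByOne (X * Y) := by
  ext1 φ
  change extendByOne X (extendByOne Y φ) = _
  rw [extendByOne_apply X, stripProj_extendByOne, extendByOne_apply Y, extendByOne_apply (X * Y)]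
  change _ = ContinuousLinearMap.adjoint (stripProj p L N) (X (Y (stripProj p L N φ))) + _
  abel

/-- Off the strip `2 - 1 = 1`, so subtracting from 2 commutes with extending by the identity. -/
theorem two_sub_extendByOne (X : Op (strip p N) L) :
    (2 : ℂ) • 1 - extendByOne X = extendByOne ((2 : ℂ) • 1 - X) := by
  ext1 φ
  rw [extendByOne_apply]
  change (2 : ℂ) • φ - extendByOne X φ = ContinuousLinearMap.adjoint (stripProj p L N)
    ((2 : ℂ) • stripProj p L N φ - X (stripProj p L N φ)) + _
  rw [extendByOne_apply, map_sub, map_smul]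
  module

/-- The reflection `1 - 2P` is `-1` on the strip and 1 off it; it absorbs the sign in the Cayley
transform `-C(2 - C)⁻¹`. -/
theorem one_sub_two_mul_extendByOne (X : Op (strip p N) L) :
    (1 - (2 : ℂ) • (ContinuousLinearMap.adjoint (stripProj p L N) ∘L stripProj p L N)) *
      extendByOne X = extendByOne (-X) := by
  ext1 φ
  rw [extendByOne_apply]
  change extendByOne X φ - (2 : ℂ) • ContinuousLinearMap.adjoint (stripProj p L N)
    (stripProj p L N (extendByOne X φ)) = ContinuousLinearMap.adjoint (stripProj p L N)
    (-(X (stripProj p L N φ))) + _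
  rw [stripProj_extendByOne, extendByOne_apply, map_neg]
  module

theorem norm_adjoint_stripProj_add_sq (ψ : L2 (strip p N) L) (φ : L2 (halfSpace p) L) :
    ‖ContinuousLinearMap.adjoint (stripProj p L N) ψ +
      (φ - ContinuousLinearMap.adjoint (stripProj p L N) (stripProj p L N φ))‖ ^ 2 =
    ‖ψ‖ ^ 2 + ‖φ - ContinuousLinearMap.adjoint (stripProj p L N) (stripProj p L N φ)‖ ^ 2 := by
  have h1 : inner ℂ (ContinuousLinearMap.adjoint (stripProj p L N) ψ)
      (φ - ContinuousLinearMap.adjoint (stripProj p L N) (stripProj p L N φ)) = 0 := by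
    rw [ContinuousLinearMap.adjoint_inner_left, map_sub, stripProj_adjoint_apply, sub_self,
      inner_zero_right]
  have h2 : ‖ContinuousLinearMap.adjoint (stripProj p L N) ψ‖ = ‖ψ‖ := by
    have h3 : inner ℂ (ContinuousLinearMap.adjoint (stripProj p L N) ψ)
        (ContinuousLinearMap.adjoint (stripProj p L N) ψ) = inner ℂ ψ ψ := by
      rw [ContinuousLinearMap.adjoint_inner_left, stripProj_adjoint_apply]
    rw [inner_self_eq_norm_sq_to_K, inner_self_eq_norm_sq_to_K] at h3
    exact (sq_eq_sq₀ (norm_nonneg _) (norm_nonneg _)).1 (by exact_mod_cast h3)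
  have := norm_add_sq_eq_norm_sq_add_norm_sq_of_inner_eq_zero _ _ h1
  rw [sq, sq, sq, this, h2]

/-- Pythagoras for the strip and its complement: only the strip component changes, and it does not
grow. -/
theorem norm_extendByOne_le {X : Op (strip p N) L} (hX : ‖X‖ ≤ 1) : ‖extendByOne X‖ ≤ 1 := by
  refine ContinuousLinearMap.opNorm_le_bound _ zero_le_one fun φ => ?_
  rw [one_mul]
  refine le_of_sq_le_sq ?_ (norm_nonneg _)
  have h1 := norm_adjoint_stripProj_add_sq (X (stripProj p L N φ)) φ
  have h2 := norm_adjoint_stripProj_add_sq (stripProj p L N φ) φ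
  rw [add_sub_cancel] at h2
  rw [extendByOne_apply, h1, h2]
  have h3 : ‖X (stripProj p L N φ)‖ ≤ ‖stripProj p L N φ‖ :=
    (X.le_opNorm _).trans (mul_le_of_le_one_left (norm_nonneg _) hX)
  have := pow_le_pow_left₀ (norm_nonneg _) h3 2
  linarith

/-- The left form shows membership in the unitized edge algebra, the right form shows that the norm
is at most 1. -/
theorem extendByOne_compress (W : Op (halfSpace p) L) :
    (ContinuousLinearMap.adjoint (stripProj p L N) ∘L stripProj p L N) * (W - 1) *
      (ContinuousLinearMap.adjoint (stripProj p L N) ∘L stripProj p L N) + 1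
      = extendByOne (compress (strip_subset p N) W) := by
  ext1 φ
  rw [extendByOne_apply]
  change ContinuousLinearMap.adjoint (stripProj p L N) (stripProj p L N
    (W (ContinuousLinearMap.adjoint (stripProj p L N) (stripProj p L N φ)) -
      ContinuousLinearMap.adjoint (stripProj p L N) (stripProj p L N φ))) + φ =
    ContinuousLinearMap.adjoint (stripProj p L N) (stripProj p L N
    (W (ContinuousLinearMap.adjoint (stripProj p L N) (stripProj p L N φ)))) + _
  rw [map_sub, map_sub, stripProj_adjoint_apply]
  abel

/-- The Green function of the strip in terms of the compression of `1 + 2iδ (Ĥ - z)⁻¹`. -/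
theorem smul_green_add {Hhat R : Op (halfSpace p) L} {z : ℂ} (δ : ℝ)
    (hR : Ring.inverse (Hhat - z • (1 : Op (halfSpace p) L)) = R) :
    ((2 * δ : ℝ) : ℂ) • green N Hhat z + Complex.I • (1 : Op (strip p N) L) =
      Complex.I • ((2 : ℂ) • 1 - compress (strip_subset p N) (1 + (2 * δ * Complex.I) • R)) ∧
    ((2 * δ : ℝ) : ℂ) • green N Hhat z - Complex.I • (1 : Op (strip p N) L) =
      -Complex.I • compress (strip_subset p N) (1 + (2 * δ * Complex.I) • R) := by
  have h1 : compress (strip_subset p N) (1 + (2 * δ * Complex.I) • R)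
      = 1 + (2 * δ * Complex.I) • green N Hhat z := by
    ext1 φ
    rw [green, hR]
    change stripProj p L N (ContinuousLinearMap.adjoint (stripProj p L N) φ +
      (2 * δ * Complex.I) • R (ContinuousLinearMap.adjoint (stripProj p L N) φ)) =
      φ + (2 * δ * Complex.I) • stripProj p L N (R (ContinuousLinearMap.adjoint (stripProj p L N) φ))
    rw [map_add, map_smul, stripProj_adjoint_apply]
  rw [h1]
  have hI : Complex.I * (2 * δ * Complex.I) = -(2 * δ) := by
    linear_combination (2 * δ : ℂ) * Complex.I_mul_I
  constructor
  · rw [smul_sub, smul_add, smul_smul, smul_smul, hI]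
    push_cast
    module
  · rw [smul_add, smul_smul, neg_mul, hI]
    push_cast
    module

/-- Dividing the two hypotheses gives the Cayley transform `-C(2 - C)⁻¹`, where `2 - C` is
invertible because `‖C‖ ≤ 1 < 2`. -/
theorem extendByOne_cayley_mul {G C : Op (strip p N) L} {δ : ℝ} (hC : ‖C‖ ≤ 1)
    (h₁ : ((2 * δ : ℝ) : ℂ) • G + Complex.I • (1 : Op (strip p N) L) =
      Complex.I • ((2 : ℂ) • 1 - C))
    (h₂ : ((2 * δ : ℝ) : ℂ) • G - Complex.I • (1 : Op (strip p N) L) = -Complex.I • C) :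
    IsUnit (((2 * δ : ℝ) : ℂ) • G + Complex.I • (1 : Op (strip p N) L)) ∧
    extendByOne (cayley δ G) * ((2 : ℂ) • 1 - extendByOne C) =
      (1 - (2 : ℂ) • (ContinuousLinearMap.adjoint (stripProj p L N) ∘L stripProj p L N)) *
        extendByOne C := by
  have hu : IsUnit (((2 * δ : ℝ) : ℂ) • G + Complex.I • (1 : Op (strip p N) L)) := by
    rw [h₁]
    have h3 : IsUnit (((2 : ℝ) : ℂ) • (1 : Op (strip p N) L) - C) :=
      isUnit_sub_of_norm_lt (hC.trans_lt one_lt_two)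
    rw [Complex.ofReal_ofNat] at h3
    exact h3.smul (Units.mk0 Complex.I Complex.I_ne_zero)
  refine ⟨hu, ?_⟩
  have h3 : (2 : ℂ) • 1 - C =
      -Complex.I • (((2 * δ : ℝ) : ℂ) • G + Complex.I • (1 : Op (strip p N) L)) := by
    rw [h₁, smul_smul, neg_mul, Complex.I_mul_I, neg_neg, one_smul]
  rw [two_sub_extendByOne, extendByOne_mul, one_sub_two_mul_extendByOne, cayley, h₂, h3,
    mul_smul_comm, mul_assoc, Ring.inverse_mul_cancel _ hu, mul_one, smul_smul, neg_mul_neg,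
    Complex.I_mul_I, neg_one_smul]

end extendByOne

/-! ### Truncation of the symbol and the final estimates -/

section final

variable {A : Type*} [CStarAlgebra A] {h : A}

/-- The symbol `(x - μ + iδ)/(x - μ - iδ)`, of modulus one. -/
noncomputable def symbol (μ δ x : ℝ) : ℂ :=
  (((x - μ : ℝ) : ℂ) + δ * Complex.I) / (((x - μ : ℝ) : ℂ) - δ * Complex.I)

theorem continuous_symbol (μ : ℝ) {δ : ℝ} (hδ : 0 < δ) : Continuous (symbol μ δ) :=
  Continuous.div (by fun_prop) (by fun_prop) fun x => sub_mul_I_ne_zero _ hδ.ne'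

theorem norm_symbol (μ : ℝ) {δ : ℝ} (hδ : 0 < δ) (x : ℝ) :
    ‖symbol μ δ x‖ = 1 := by
  rw [symbol, div_eq_exp_arctan _ hδ, show ∀ r : ℝ, -(2 * Real.pi * Complex.I) * (r : ℂ)
    = ((-(2 * Real.pi * r) : ℝ) : ℂ) * Complex.I from fun r => by push_cast; ring,
    Complex.norm_exp_ofReal_mul_I]

/-- `(h - μ + iδ)(h - μ - iδ)⁻¹ = 1 + 2iδ (h - μ - iδ)⁻¹`. -/
theorem rcfc_symbol_eq (ha : IsSelfAdjoint h) (μ : ℝ) {δ : ℝ} (hδ : 0 < δ) :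
    rcfc (symbol μ δ) h = 1 + (2 * δ * Complex.I) • Ring.inverse (h - (μ + δ * Complex.I : ℂ) • (1 : A)) := by
  have hne : ∀ x : ℝ, (x : ℂ) - (μ + δ * Complex.I) ≠ 0 := fun x => by
    have := sub_mul_I_ne_zero (x - μ) hδ.ne'
    push_cast at this
    rwa [sub_sub] at this
  have hc : Continuous fun x : ℝ => ((x : ℂ) - (μ + δ * Complex.I))⁻¹ :=
    Continuous.inv₀ (by fun_prop) hne
  have hz : rcfc (fun x : ℝ => (x : ℂ) - (μ + δ * Complex.I)) h
      = h - (μ + δ * Complex.I : ℂ) • (1 : A) := by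
    rw [rcfc_sub (by fun_prop) (by fun_prop), rcfc_ofReal ha, rcfc_const _ ha]
  have h1 : rcfc (fun x : ℝ => ((x : ℂ) - (μ + δ * Complex.I))⁻¹) h *
      (h - (μ + δ * Complex.I : ℂ) • (1 : A)) = 1 := by
    rw [← hz, ← rcfc_mul hc (by fun_prop)]
    simp only [inv_mul_cancel₀ (hne _)]
    exact rcfc_one ha
  have h2 : (h - (μ + δ * Complex.I : ℂ) • (1 : A)) *
      rcfc (fun x : ℝ => ((x : ℂ) - (μ + δ * Complex.I))⁻¹) h = 1 := by
    rw [← hz, ← rcfc_mul (by fun_prop) hc]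
    simp only [mul_inv_cancel₀ (hne _)]
    exact rcfc_one ha
  have h3 : Ring.inverse (h - (μ + δ * Complex.I : ℂ) • (1 : A)) =
      rcfc (fun x : ℝ => ((x : ℂ) - (μ + δ * Complex.I))⁻¹) h :=
    Ring.inverse_unit ⟨_, _, h2, h1⟩
  rw [h3, ← rcfc_const_mul _ hc, ← rcfc_one ha, ← rcfc_add continuous_const (by fun_prop)]
  congr 1
  ext x
  have h4 : (((x - μ : ℝ) : ℂ) - δ * Complex.I) = (x : ℂ) - (μ + δ * Complex.I) := by
    push_cast; ring
  rw [symbol, h4, div_eq_iff (hne x), add_mul, mul_assoc (2 * (δ : ℂ) * Complex.I),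
    inv_mul_cancel₀ (hne x)]
  push_cast
  ring

/-- Truncating `W - 1 = 2iδ (h - μ - iδ)⁻¹` to the range of a projection `P` is a small
perturbation, if a cutoff function of `h` is small off the range of `P` and `δ` is small. -/
theorem norm_truncation_sub_le {P : A} {χ : ℝ → ℂ} {μ c δ ε : ℝ} (hP : ‖P‖ ≤ 1)
    (hQ : ‖1 - P‖ ≤ 1) (ha : IsSelfAdjoint h) (hc : 0 < c) (hχ : Continuous χ)
    (hχ1 : ∀ x, |x - μ| ≤ c → χ x = 1) (hχ2 : ∀ x, ‖1 - χ x‖ ≤ 1) (hδ : 0 < δ)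
    (h₁ : ‖rcfc χ h * (1 - P)‖ ≤ ε) (h₂ : ‖(1 - P) * rcfc χ h‖ ≤ ε) {W : A}
    (hW : W = rcfc (symbol μ δ) h) :
    ‖P * (W - 1) * P + 1 - W‖ ≤ 2 * (2 * ε + 2 * δ / c) := by
  have hwc : Continuous (symbol μ δ) := continuous_symbol μ hδ
  have hw1 : W - 1 = rcfc (fun x => symbol μ δ x - 1) h := by
    rw [hW, rcfc_sub hwc continuous_const, rcfc_one ha]
  set ρ : ℝ → ℂ := fun x => symbol μ δ x - 1 with hρ
  have hρc : Continuous ρ := by fun_prop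
  have hρ2 : ∀ x, ‖ρ x‖ ≤ 2 := fun x => by
    refine (norm_sub_le _ _).trans ?_
    rw [norm_symbol μ hδ x, norm_one]
    norm_num
  -- Where `χ = 1` the product vanishes; elsewhere `|x - μ| > c`, and `ρ = 2iδ/(x - μ - iδ)` is at
  -- most `2δ/c`.
  have hρ3 : ∀ x, ‖ρ x * (1 - χ x)‖ ≤ 2 * δ / c := fun x => by
    by_cases hx : |x - μ| ≤ c
    · rw [hχ1 x hx, sub_self, mul_zero, norm_zero]; positivity
    · rw [not_le] at hx
      have hne := sub_mul_I_ne_zero (x - μ) hδ.ne'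
      have e1 : ρ x = ((2 * δ : ℝ) : ℂ) * Complex.I / (((x - μ : ℝ) : ℂ) - δ * Complex.I) := by
        simp only [hρ]
        rw [symbol, div_sub_one hne]
        congr 1
        push_cast
        ring
      rw [norm_mul]
      refine (mul_le_of_le_one_right (norm_nonneg _) (hχ2 x)).trans ?_
      rw [e1, norm_div, norm_mul, Complex.norm_I, mul_one, Complex.norm_real,
        Real.norm_of_nonneg (by positivity)]
      exact div_le_div_of_nonneg_left (by positivity) hc
        (hx.le.trans (abs_le_norm_sub_mul_I _ _))
  have hr : ‖rcfc ρ h‖ ≤ 2 := norm_rcfc_le zero_le_two hρ2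
  have hr' : ‖rcfc (fun x => ρ x * (1 - χ x)) h‖ ≤ 2 * δ / c := norm_rcfc_le (by positivity) hρ3
  -- The part of `ρ` near `μ` inherits the decay of `χ(h)` off the range of `P`; the remaining part
  -- is small in norm.
  have hs₁ : rcfc ρ h = rcfc ρ h * rcfc χ h + rcfc (fun x => ρ x * (1 - χ x)) h := by
    rw [← rcfc_mul hρc hχ, ← rcfc_add (by fun_prop) (by fun_prop)]
    congr 1
    ext x
    ring
  have hs₂ : rcfc ρ h = rcfc χ h * rcfc ρ h + rcfc (fun x => ρ x * (1 - χ x)) h := by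
    rw [← rcfc_mul hχ hρc, ← rcfc_add (by fun_prop) (by fun_prop)]
    congr 1
    ext x
    ring
  have b₁ : ‖rcfc ρ h * (1 - P)‖ ≤ 2 * ε + 2 * δ / c := by
    rw [hs₁, add_mul, mul_assoc]
    refine (norm_add_le _ _).trans (add_le_add ?_ ?_)
    · exact (norm_mul_le _ _).trans (mul_le_mul hr h₁ (norm_nonneg _) zero_le_two)
    · exact (norm_mul_le _ _).trans ((mul_le_of_le_one_right (norm_nonneg _) hQ).trans hr')
  have b₂ : ‖(1 - P) * rcfc ρ h‖ ≤ 2 * ε + 2 * δ / c := by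
    rw [hs₂, mul_add, ← mul_assoc]
    refine (norm_add_le _ _).trans (add_le_add ?_ ?_)
    · refine (norm_mul_le _ _).trans ?_
      rw [mul_comm 2 ε]
      exact mul_le_mul h₂ hr (norm_nonneg _) ((norm_nonneg _).trans h₂)
    · exact (norm_mul_le _ _).trans ((mul_le_of_le_one_left (norm_nonneg _) hQ).trans hr')
  have e : P * (W - 1) * P + 1 - W = -((1 - P) * (W - 1) + P * ((W - 1) * (1 - P))) := by
    noncomm_ring
  rw [e, norm_neg, hw1, two_mul]
  refine (norm_add_le _ _).trans (add_le_add b₂ ?_)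
  exact (norm_mul_le _ _).trans ((mul_le_of_le_one_left (norm_nonneg _) hP).trans b₁)

end final

theorem norm_one_sub_stripFamily_le {p L : ℕ} {Ω : Type*} [NeZero L] (N : ℕ) :
    ‖1 - stripFamily p L Ω N‖ ≤ 1 := by
  refine Family.norm_le zero_le_one fun ω => ?_
  have h : (1 - stripFamily p L Ω N : HalfFamily p L Ω) ω
      = extendByOne (0 : Op (strip p N) L) := by
    ext1 φ
    rw [extendByOne_apply]
    change φ - ContinuousLinearMap.adjoint (stripProj p L N) (stripProj p L N φ) =
      ContinuousLinearMap.adjoint (stripProj p L N) 0 + _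
    rw [map_zero, zero_add]
  rw [h]
  exact norm_extendByOne_le (by simp)

/-- The relation between the two classes, provided that truncating the symbol to the strip is a small
perturbation. -/
theorem exists_units_of_norm_truncation_le {p L : ℕ} [NeZero L] {Ω : Type*} [TopologicalSpace Ω]
    [AddAction (Fin (p + 1) → ℤ) Ω] {B : Matrix (Fin (p + 1)) (Fin (p + 1)) ℝ}
    {H : Family (Set.univ : Set (Fin (p + 1) → ℤ)) L Ω} (hloc : IsLocal B ⊤ fun ω => H ω)
    (hself : IsSelfAdjoint H) {a b μ δ : ℝ}
    (hE : ∀ F : ℝ → ℂ, Continuous F → (∀ x ∉ Set.Ioo a b, F x = 0) →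
      rcfc F H.toHalf ∈ edgeUnitization p L Ω B)
    {f g : ℝ → ℝ} (hf : Continuous f) (hg : Continuous g)
    (hf0 : ∀ x ≤ a, f x = 0) (hf1 : ∀ x, b ≤ x → f x = 1)
    (hg0 : ∀ x ≤ a, g x = 0) (hg1 : ∀ x, b ≤ x → g x = 1) (hδ : 0 < δ)
    (hgw : ∀ x, ‖symbol μ δ x - Complex.exp (-(2 * Real.pi * Complex.I) * g x)‖ ≤ 1 / 4)
    (N : ℕ) (htr : ‖stripFamily p L Ω N * (rcfc (symbol μ δ) H.toHalf - 1) * stripFamily p L Ω N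
      + 1 - rcfc (symbol μ δ) H.toHalf‖ ≤ 1 / 2) :
    (∀ ω, IsUnit (((2 * δ : ℝ) : ℂ) • green N (halfRestriction (H ω)) (μ + δ * Complex.I) +
          Complex.I • (1 : Op (strip p N) L))) ∧
        ∃ u v : (edgeUnitization p L Ω B)ˣ,
          (∀ ω, (u : HalfFamily p L Ω) ω = expRep f (halfRestriction (H ω))) ∧
          (∀ ω, (v : HalfFamily p L Ω) ω = extendByOne (cayley δ
              (green N (halfRestriction (H ω)) (μ + δ * Complex.I)))) ∧
          KOne.ofUnit u = -KOne.ofUnit v := by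
  have hsh := isSelfAdjoint_toHalf hself
  have hWc := continuous_symbol μ hδ
  have hWω : ∀ ω, rcfc (symbol μ δ) H.toHalf ω = 1 + (2 * δ * Complex.I) •
      Ring.inverse (halfRestriction (H ω) - (μ + δ * Complex.I : ℂ) • 1) := fun ω => by
    rw [eval_rcfc hsh hWc]
    exact rcfc_symbol_eq (isSelfAdjoint_apply hsh ω) μ hδ
  have hWn : ‖rcfc (symbol μ δ) H.toHalf‖ ≤ 1 :=
    norm_rcfc_le zero_le_one fun x => (norm_symbol μ hδ x).le
  have hCS : stripFamily p L Ω N * (rcfc (symbol μ δ) H.toHalf - 1) * stripFamily p L Ω N + 1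
      ∈ edgeUnitization p L Ω B := by
    refine add_mem (edgeAlgebra_le_edgeUnitization ?_) (one_mem _)
    rw [← rcfc_one hsh, ← rcfc_sub hWc continuous_const]
    exact stripFamily_mul_rcfc_mul_mem hloc hself (hWc.sub continuous_const) N
  have hgw' : ‖rcfc (symbol μ δ) H.toHalf -
      rcfc (fun x => Complex.exp (-(2 * Real.pi * Complex.I) * g x)) H.toHalf‖ ≤ 1 / 4 := by
    rw [← rcfc_sub hWc (by fun_prop)]
    exact norm_rcfc_le (by norm_num) hgw
  generalize rcfc (symbol μ δ) H.toHalf = W at *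
  set C : HalfFamily p L Ω := stripFamily p L Ω N * (W - 1) * stripFamily p L Ω N + 1 with hC
  have hCω : ∀ ω, C ω = extendByOne (compress (strip_subset p N) (W ω)) := fun ω =>
    extendByOne_compress (W ω)
  have hcomp : ∀ ω, ‖compress (strip_subset p N) (W ω)‖ ≤ 1 := fun ω =>
    (norm_compress_le _ _).trans ((Family.norm_apply_le W ω).trans hWn)
  have hCn : ‖C‖ ≤ 1 := Family.norm_le zero_le_one fun ω => by
    rw [hCω]
    exact norm_extendByOne_le (hcomp ω)
  have hnear : ‖C - rcfc (fun x => Complex.exp (-(2 * Real.pi * Complex.I) * g x)) H.toHalf‖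
      < 1 := by
    -- The truncation error `1/2` and the switch error `1/4` add up to less than 1.
    have h4 := norm_sub_le_norm_sub_add_norm_sub C W
      (rcfc (fun x => Complex.exp (-(2 * Real.pi * Complex.I) * g x)) H.toHalf)
    linarith
  have hcay := fun ω => by
    have h1 := smul_green_add (N := N) δ (rfl : Ring.inverse (halfRestriction (H ω) -
      (μ + δ * Complex.I : ℂ) • (1 : Op (halfSpace p) L)) = _)
    rw [← hWω ω] at h1
    exact extendByOne_cayley_mul (hcomp ω) h1.1 h1.2
  refine ⟨fun ω => (hcay ω).1, ?_⟩
  have key := KOne.exists_units_eq_neg (A := HalfFamily p L Ω) (S := edgeUnitization p L Ω B)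
    (h := H.toHalf) (a := a) (b := b) (f := f) (g := g) (P := stripFamily p L Ω N) (C := C)
    isClosed_edgeUnitization hsh hE hf hg hf0 hf1 hg0 hg1 (stripFamily_mul_self N)
    (edgeAlgebra_le_edgeUnitization (stripFamily_mem_edgeAlgebra N)) hCS hCn hnear
  obtain ⟨u, v, hu, hv, huv⟩ := key
  refine ⟨u, v, fun ω => ?_, fun ω => ?_, huv⟩
  · rw [hu, eval_rcfc hsh (by fun_prop), expRep]
    exact (exp_smul_cfc (isSelfAdjoint_apply hsh ω) hf _).symm
  · have h1 : ((v : edgeUnitization p L Ω B) : HalfFamily p L Ω) ω * ((2 : ℂ) • 1 - C ω) =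
        (1 - (2 : ℂ) • (ContinuousLinearMap.adjoint (stripProj p L N) ∘L stripProj p L N)) * C ω :=
      congrArg (fun T : HalfFamily p L Ω => T ω) hv
    -- The unit `v` is known only through `v(2 - C) = (1 - 2P)C`; cancelling `2 - C` at each `ω`
    -- identifies it with the Cayley transform.
    have h2 : IsUnit (((2 : ℝ) : ℂ) • (1 : Op (halfSpace p) L) - C ω) :=
      isUnit_sub_of_norm_lt (((Family.norm_apply_le C ω).trans hCn).trans_lt one_lt_two)
    rw [Complex.ofReal_ofNat] at h2
    refine h2.mul_left_injective ?_
    change _ * _ = _ * _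
    rw [h1, hCω ω, (hcay ω).2]

/-- The class of the exponential of the edge Hamiltonian is the negative of the class of the Cayley
transform of the Green function of a wide strip, for small imaginary parts. -/
theorem exists_units_ofUnit_eq_neg
    (p L : ℕ) [NeZero L]
    (Ω : Type*) [TopologicalSpace Ω] [CompactSpace Ω] [MeasurableSpace Ω]
    [AddAction (Fin (p + 1) → ℤ) Ω]
    (P : Measure Ω) [P.IsOpenPosMeasure]
    (B : Matrix (Fin (p + 1)) (Fin (p + 1)) ℝ)
    (H : Ω → Op (Set.univ : Set (Fin (p + 1) → ℤ)) L)
    (hself : ∀ ω, IsSelfAdjoint (H ω))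
    (hcov : IsCovariant B ⊤ H)
    (hrange : IsShortRange H)
    (hcont : HasContinuousEntries H)
    (a b μ : ℝ) (hμ : μ ∈ Set.Ioo a b)
    (hgap : ∀ᵐ ω ∂P, Disjoint (spectrum ℝ (H ω)) (Set.Ioo a b)) :
    ∃ N₀ : ℕ, ∃ δ₀ : ℝ, 0 < δ₀ ∧
      ∀ f : ℝ → ℝ, ContDiff ℝ (⊤ : ℕ∞) f → Monotone f → (∀ E, f E ∈ Set.Icc (0 : ℝ) 1) →
        (∀ E ≤ a, f E = 0) → (∀ E, b ≤ E → f E = 1) →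
      ∀ N : ℕ, N₀ ≤ N → ∀ δ : ℝ, 0 < δ → δ < δ₀ →
        (∀ ω, IsUnit (((2 * δ : ℝ) : ℂ) •
            green N (halfRestriction (H ω)) (μ + δ * Complex.I) +
          Complex.I • (1 : Op (strip p N) L))) ∧
        ∃ u v : (edgeUnitization p L Ω B)ˣ,
          (∀ ω, (u : HalfFamily p L Ω) ω =
            expRep f (halfRestriction (H ω))) ∧
          (∀ ω, (v : HalfFamily p L Ω) ω =
            extendByOne (cayley δ
              (green N (halfRestriction (H ω)) (μ + δ * Complex.I)))) ∧
          KOne.ofUnit u = -KOne.ofUnit v := by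
  have hloc : IsLocal B ⊤ H := ⟨hcov, hrange, hcont⟩
  obtain ⟨K, hK⟩ := hloc.exists_norm_le
  set Hb : Family (Set.univ : Set (Fin (p + 1) → ℤ)) L Ω := Family.mk H hK with hHb
  have hlocb : IsLocal B ⊤ fun ω => Hb ω := hloc
  have hsb : IsSelfAdjoint Hb := by
    ext ω : 2
    exact hself ω
  have hzero : ∀ F : ℝ → ℂ, Continuous F → (∀ x ∉ Set.Ioo a b, F x = 0) → rcfc F Hb = 0 :=
    fun F hF hF0 => rcfc_eq_zero_of_ae_gap hlocb hsb hgap hF hF0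
  have hE : ∀ F : ℝ → ℂ, Continuous F → (∀ x ∉ Set.Ioo a b, F x = 0) →
      rcfc F Hb.toHalf ∈ edgeUnitization p L Ω B := fun F hF hF0 =>
    edgeAlgebra_le_edgeUnitization (rcfc_mem_edgeAlgebra hlocb hsb hF (hzero F hF hF0))
  obtain ⟨χ, c, hc, hχ, hχ0, hχ1, hχ2⟩ := exists_cutoff hμ
  obtain ⟨δ₁, hδ₁, hswitch⟩ := exists_switch_near hμ
  -- The width comes from the cutoff alone, which depends on `a`, `b`, `μ`; hence `N₀` is
  -- independent of `δ` and `f`.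
  obtain ⟨N₀, hN₀⟩ := exists_norm_rcfc_mul_compl_le hlocb hsb hχ (hzero χ hχ hχ0)
    (ε := 1 / 32) (by norm_num)
  -- With `ε = 1/32` and `2δ/c ≤ 1/16` the truncation error is at most `2(1/16 + 1/16) = 1/4`.
  refine ⟨N₀, min δ₁ (c / 32), lt_min hδ₁ (by positivity), ?_⟩
  intro f hf _ _ hf0 hf1 N hN δ hδ hδ₀
  obtain ⟨g, hg, hg0, hg1, hgw⟩ := hswitch δ hδ (hδ₀.trans_le (min_le_left _ _))
  obtain ⟨hN1, hN2⟩ := hN₀ N hN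
  have htr := norm_truncation_sub_le (A := HalfFamily p L Ω) (h := Hb.toHalf)
    (P := stripFamily p L Ω N) (χ := χ) (μ := μ) (c := c) (δ := δ) (ε := 1 / 32)
    (W := rcfc (symbol μ δ) Hb.toHalf) (norm_stripFamily_le N) (norm_one_sub_stripFamily_le N)
    (isSelfAdjoint_toHalf hsb) hc hχ hχ1 hχ2 hδ hN1 hN2 rfl
  refine exists_units_of_norm_truncation_le hlocb hsb hE hf.continuous hg hf0 hf1 hg0 hg1 hδ hgw N
    (htr.trans ?_)
  have h3 : 2 * δ / c ≤ 1 / 16 := by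
    rw [div_le_iff₀ hc]
    linarith [hδ₀.trans_le (min_le_right δ₁ (c / 32))]
  linarith

end TightBinding

theorem mainTheorem4
    (p L : ℕ) [NeZero L] (hd : Even (p + 1))
    (Ω : Type*) [TopologicalSpace Ω] [CompactSpace Ω] [MeasurableSpace Ω] [BorelSpace Ω]
    [AddAction (Fin (p + 1) → ℤ) Ω] [ContinuousConstVAdd (Fin (p + 1) → ℤ) Ω]
    (P : Measure Ω) [IsProbabilityMeasure P] [ErgodicVAdd (Fin (p + 1) → ℤ) Ω P]
    [P.IsOpenPosMeasure]
    (B : Matrix (Fin (p + 1)) (Fin (p + 1)) ℝ)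
    (H : Ω → TightBinding.Op (Set.univ : Set (Fin (p + 1) → ℤ)) L)
    (hself : ∀ ω, IsSelfAdjoint (H ω))
    (hcov : TightBinding.IsCovariant B ⊤ H)
    (hrange : TightBinding.IsShortRange H)
    (hcont : TightBinding.HasContinuousEntries H)
    (a b μ : ℝ) (hμ : μ ∈ Set.Ioo a b)
    (hgap : ∀ᵐ ω ∂P, Disjoint (spectrum ℝ (H ω)) (Set.Ioo a b)) :
    ∃ N₀ : ℕ, ∃ δ₀ : ℝ, 0 < δ₀ ∧
      ∀ f : ℝ → ℝ, ContDiff ℝ (⊤ : ℕ∞) f → Monotone f → (∀ E, f E ∈ Set.Icc (0 : ℝ) 1) →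
        (∀ E ≤ a, f E = 0) → (∀ E, b ≤ E → f E = 1) →
      ∀ N : ℕ, N₀ ≤ N → ∀ δ : ℝ, 0 < δ → δ < δ₀ →
        (∀ ω, IsUnit (((2 * δ : ℝ) : ℂ) •
            TightBinding.green N (TightBinding.halfRestriction (H ω)) (μ + δ * Complex.I) +
          Complex.I • (1 : TightBinding.Op (TightBinding.strip p N) L))) ∧
        ∃ u v : (TightBinding.edgeUnitization p L Ω B)ˣ,
          (∀ ω, (u : TightBinding.HalfFamily p L Ω) ω =
            TightBinding.expRep f (TightBinding.halfRestriction (H ω))) ∧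
          (∀ ω, (v : TightBinding.HalfFamily p L Ω) ω =
            TightBinding.extendByOne (TightBinding.cayley δ
              (TightBinding.green N (TightBinding.halfRestriction (H ω)) (μ + δ * Complex.I)))) ∧
          KOne.ofUnit u = -KOne.ofUnit v :=
  TightBinding.exists_units_ofUnit_eq_neg p L Ω P B H hself hcov hrange hcont a b μ hμ hgap
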